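/- **Conventions.** Let $\Sigma$ be a connected Riemann surface, not necessarily compact. Let $D=\sum_{i=1}^n(\alpha_i-1)p_i-\sum_{j=1}^m q_j$ be an $\mathbb R$-divisor with distinct points $p_1,\dots,p_n,q_1,\dots,q_m\in\Sigma$ and $0<\alpha_i\neq 1$, and put $\Sigma^*=\Sigma\setminus\{p_1,\dots,p_n,q_1,\dots,q_m\}$. Let $X\in\{\mathbb D,\mathbb H\}$, with hyperbolic metric $d\sigma_0^2=\frac{4|dw|^2}{(1-|w|^2)^2}$ and $G=\mathrm{PSU}(1,1)$ if $X=\mathbb D$, and $d\sigma_0^2=\frac{|dw|^2}{(\operatorname{Im}w)^2}$ and $G=\mathrm{PSL}(2,\mathbb R)$ if $X=\mathbb H$. A multivalued function on $\Sigma^*$ is a function on a path-connected covering space of $\Sigma^*$ (for instance the universal covering); its function elements are its local branches. It is *projective* if its function elements are holomorphic and locally univalent (for values in $X$ meromorphic means holomorphic) and any two of them at the same point are related by an element of $\mathrm{PGL}(2,\mathbb C)$. Its monodromy lies in $G$ if continuation of a function element along any loop composes it with an element of $G$. The Schwarzian derivative is $\{F,z\}=\frac{F'''}{F'}-\frac32\left(\frac{F''}{F'}\right)^2$.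 **Lemma 2.4.** Let $F$ be a projective multivalued function on $\Sigma^*$ with values in $X$ and monodromy in $G$. Suppose that near each $p_i$, in some coordinate $z$ with $z(p_i)=0$, $$\{F,z\}=\frac{1-\alpha_i^2}{2z^2}+\frac{d_i}{z}+\phi_i(z),$$ and near each $q_j$, in some coordinate $z$ with $z(q_j)=0$, $$\{F,z\}=\frac{1}{2z^2}+\frac{e_j}{z}+\psi_j(z),$$ with constants $d_i,e_j$ and holomorphic functions $\phi_i,\psi_j$. Then: 1. For each $i$ there is a connected neighborhood $U$ of $p_i$ containing no other $p_k$ and no $q_k$, with a complex coordinate $z$, $z(p_i)=0$, such that for each multivalued function on $U\setminus\{p_i\}$ obtained from a function element of $F$ over $U\setminus\{p_i\}$ by continuation inside $U\setminus\{p_i\}$ there is $\mathfrak L\in\mathrm{PGL}(2,\mathbb C)$ with $\mathfrak L\circ F=z^{\alpha_i}$ (every function element of $\mathfrak L\circ F$ is a branch of $z^{\alpha_i}=e^{\alpha_i\log z}$). 2. For each $j$ there is a connected neighborhood $U$ of $q_j$ containing no $p_k$ and no other $q_k$, with a complex coordinate $z$, $z(q_j)=0$, such that in the same sense $\mathfrak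 L\circ F=\log z$ on $U\setminus\{q_j\}$ for some $\mathfrak L\in\mathrm{PGL}(2,\mathbb C)$. 3. $F^*d\sigma_0^2$ is a well-defined smooth conformal metric on $\Sigma^*$ of Gaussian curvature $-1$ that represents $D$. That is, writing it as $e^{2u}|dz|^2$ in a suitable coordinate $z$ centered at the point, near $p_i$ the function $u-(\alpha_i-1)\ln|z|$ extends continuously to $p_i$, and near $q_j$ the function $u+\ln|z|+\ln(-\ln|z|)$ extends continuously to $q_j$. -/

import Mathlib

open scoped Manifold ContDiff Topology
open Set

noncomputable section

namespace HypSing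

universe u v

/-- A multivalued complex function on `M \ S`: a function `toFun` on a (path-connected, surjective)
covering space `cover` of `M \ S`, for instance on the universal covering. Its branches over a
point `p` are the values of `toFun` near the points of the fibre over `p`. -/
structure MultivaluedFunction (M : Type u) [TopologicalSpace M] (S : Set M) where
  cover : Type v
  [topCover : TopologicalSpace cover]
  [pathConnected : PathConnectedSpace cover]
  proj : cover → ↥Sᶜ
  isCovering : IsCoveringMap proj
  surjective : Function.Surjective proj
  toFun : cover → ℂ

attribute [instance] MultivaluedFunction.topCover MultivaluedFunction.pathConnected

section

variable {M : Type u} [TopologicalSpace M] {S : Set M}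

/-- `g` is the function element (germ of a branch) of `F` at the point `x` of the covering; it is
a germ at the point of `M` under `x`. -/
def IsElement (F : MultivaluedFunction.{u, v} M S) (x : F.cover) (g : M → ℂ) : Prop :=
  ∀ᶠ y in 𝓝 x, F.toFun y = g (F.proj y)

/-- The function element of `F` at `x` is `L` composed with the function element of `F` at `y`
(used for `x`, `y` over the same point), where `L` acts on the Riemann sphere `OnePoint ℂ` by
fractional linear transformation. -/
def ElementsRelated (F : MultivaluedFunction.{u, v} M S) (x y : F.cover)
    (L : GL (Fin 2) ℂ) : Prop :=
  ∀ g₁ g₂ : M → ℂ, IsElement F x g₁ → IsElement F y g₂ →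
    ∀ᶠ q in 𝓝 (F.proj x : M), (g₁ q : OnePoint ℂ) = L • (g₂ q : OnePoint ℂ)

/-- The monodromy of `F` lies in the set `Γ` of fractional linear transformations: continuing a
function element of `F` along a loop replaces it by its composition with an element of `Γ`.
(`F.isCovering.monodromy γ x` is the end point of the lift of the loop `γ` starting at `x`.) -/
def MonodromyIn (F : MultivaluedFunction.{u, v} M S) (Γ : Set (GL (Fin 2) ℂ)) : Prop :=
  ∀ (p : ↥Sᶜ) (γ : Path.Homotopic.Quotient p p) (x : F.proj ⁻¹' {p}),
    ∃ L ∈ Γ, ElementsRelated F (F.isCovering.monodromy γ x : F.cover) x L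

end

/-- Matrices of the elements of `PSU(1,1)`. -/
def PSU11 : Set (GL (Fin 2) ℂ) :=
  {L | ∃ a b : ℂ, ‖a‖ ^ 2 - ‖b‖ ^ 2 = 1 ∧
    (L : Matrix (Fin 2) (Fin 2) ℂ) = !![a, b; star b, star a]}

/-- Matrices of the elements of `PSL(2,ℝ)`. -/
def PSL2R : Set (GL (Fin 2) ℂ) :=
  {L | ∃ a b c d : ℝ, a * d - b * c = 1 ∧
    (L : Matrix (Fin 2) (Fin 2) ℂ) = !![(a : ℂ), (b : ℂ); (c : ℂ), (d : ℂ)]}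

/-- The Schwarzian derivative `f'''/f' - (3/2) (f''/f')²`. -/
def schwarzian (f : ℂ → ℂ) (z : ℂ) : ℂ :=
  iteratedDeriv 3 f z / deriv f z - 3 / 2 * (iteratedDeriv 2 f z / deriv f z) ^ 2

/-- The density `4 / (1 - |w|²)²` of the hyperbolic metric of the unit disk. -/
def diskDensity (w : ℂ) : ℝ := 4 / (1 - ‖w‖ ^ 2) ^ 2

/-- The density `1 / (Im w)²` of the hyperbolic metric of the upper half-plane. -/
def halfPlaneDensity (w : ℂ) : ℝ := 1 / w.im ^ 2

section

variable {M : Type u} [TopologicalSpace M] [ChartedSpace ℂ M]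

/-- `e` is a complex coordinate of the Riemann surface `M`, defined on `e.source`. -/
def IsCoord (e : OpenPartialHomeomorph M ℂ) : Prop :=
  e ∈ IsManifold.maximalAtlas 𝓘(ℂ) ω M

/-- `e` is a complex coordinate on a neighbourhood `e.source` of `p`, which contains no point of
`S` other than `p`, and `e p = 0`. -/
def IsCenteredCoord (S : Set M) (p : M) (e : OpenPartialHomeomorph M ℂ) : Prop :=
  IsCoord e ∧ p ∈ e.source ∧ e p = 0 ∧ e.source ∩ S ⊆ {p}

variable {S : Set M}

/-- `F` is holomorphic and locally univalent: in every coordinate its function elements are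
holomorphic with non-zero derivative. -/
def IsLocallyUnivalent (F : MultivaluedFunction.{u, v} M S) : Prop :=
  ∀ x : F.cover, ∃ g : M → ℂ, IsElement F x g ∧
    ∀ e : OpenPartialHomeomorph M ℂ, IsCoord e → (F.proj x : M) ∈ e.source →
      AnalyticAt ℂ (g ∘ e.symm) (e (F.proj x)) ∧ deriv (g ∘ e.symm) (e (F.proj x)) ≠ 0

/-- `F` is projective: it is locally univalent and any two function elements at the same point are
related by a fractional linear transformation. (Finite values: a meromorphic function with values
in the disk or in the upper half-plane is holomorphic.) -/
def IsProjective (F : MultivaluedFunction.{u, v} M S) : Prop :=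
  IsLocallyUnivalent F ∧
    ∀ x y : F.cover, F.proj x = F.proj y → ∃ L : GL (Fin 2) ℂ, ElementsRelated F x y L

/-- Near `p`, in some coordinate `z` centered at `p`, the Schwarzian derivative of (every function
element of) `F` equals `(1 - θ²) / (2 z²) + d / z + φ(z)` with `d` constant, `φ` holomorphic. -/
def SchwarzianForm (F : MultivaluedFunction.{u, v} M S) (p : M) (θ : ℝ) : Prop :=
  ∃ e : OpenPartialHomeomorph M ℂ, IsCenteredCoord S p e ∧
    ∃ (d : ℂ) (φ : ℂ → ℂ), DifferentiableOn ℂ φ e.target ∧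
      ∀ (x : F.cover) (g : M → ℂ), (F.proj x : M) ∈ e.source → IsElement F x g →
        schwarzian (g ∘ e.symm) (e (F.proj x)) =
          (1 - (θ : ℂ) ^ 2) / (2 * e (F.proj x) ^ 2) + d / e (F.proj x) + φ (e (F.proj x))

/-- `F` is compatible with the divisor `D = ∑ (θ_p - 1) p`. -/
def IsCompatible (D : M →₀ ℝ) (F : MultivaluedFunction.{u, v} M (D.support : Set M)) : Prop :=
  ∀ p ∈ D.support, SchwarzianForm F p (1 + D p)

/-- `ℓ` is, near `p`, a (continuous, hence holomorphic) branch of the logarithm of the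
coordinate `e`. -/
def IsLogBranch (e : OpenPartialHomeomorph M ℂ) (p : M) (ℓ : M → ℂ) : Prop :=
  ∀ᶠ q in 𝓝 p, ContinuousAt ℓ q ∧ Complex.exp (ℓ q) = e q

/-- Up to a fractional linear transformation, `F` has the form `Φ (log z)` near `p`: there is a
connected neighbourhood `U` of `p` with a coordinate `z` centered at `p` such that for every
connected component of the part of the covering over `U \ {p}` (that is, for every multivalued
function on `U \ {p}` obtained from a function element of `F` by continuation inside `U \ {p}`)
there is an `L` such that every function element of `L ∘ F` on this component is `Φ ∘ ℓ` for
some branch `ℓ` of `log z`. -/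
def HasLocalForm (F : MultivaluedFunction.{u, v} M S) (p : M) (Φ : ℂ → ℂ) : Prop :=
  ∃ e : OpenPartialHomeomorph M ℂ, IsCenteredCoord S p e ∧ IsConnected e.source ∧
    ∀ x₀ : F.cover, (F.proj x₀ : M) ∈ e.source →
      ∃ L : GL (Fin 2) ℂ,
        ∀ x ∈ connectedComponentIn {y : F.cover | (F.proj y : M) ∈ e.source} x₀,
          ∃ ℓ : M → ℂ, IsLogBranch e (F.proj x) ℓ ∧
            ∀ᶠ y in 𝓝 x, L • (F.toFun y : OnePoint ℂ) = (Φ (ℓ (F.proj y)) : OnePoint ℂ)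

/-- `L ∘ F` has the form `z ^ α = exp (α log z)` near `p`. -/
def HasPowerForm (F : MultivaluedFunction.{u, v} M S) (p : M) (α : ℝ) : Prop :=
  HasLocalForm F p (fun w => Complex.exp (α * w))

/-- `L ∘ F` has the form `log z` near `p`. -/
def HasLogForm (F : MultivaluedFunction.{u, v} M S) (p : M) : Prop :=
  HasLocalForm F p (fun w => w)

/-- A smooth conformal metric on `M \ S`: in each coordinate `z = e` it is `ρ |dz|²`, where
`ρ = density e` is a positive smooth function, with the usual transformation rule. -/
structure ConformalMetric (M : Type u) [TopologicalSpace M] [ChartedSpace ℂ M] (S : Set M) where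
  density : OpenPartialHomeomorph M ℂ → M → ℝ
  pos : ∀ e, IsCoord e → ∀ q ∈ e.source \ S, 0 < density e q
  smooth : ∀ e, IsCoord e → ContDiffOn ℝ ∞ (density e ∘ e.symm) (e.target ∩ e.symm ⁻¹' Sᶜ)
  transform : ∀ e e', IsCoord e → IsCoord e' → ∀ q ∈ (e.source ∩ e'.source) \ S,
    density e q = density e' q * ‖deriv (e' ∘ e.symm) (e q)‖ ^ 2

/-- The function `u` with `ρ |dz|² = e^{2u} |dz|²` in the coordinate `e`. -/
def ConformalMetric.logDensity (σ : ConformalMetric M S) (e : OpenPartialHomeomorph M ℂ)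
    (q : M) : ℝ :=
  1 / 2 * Real.log (σ.density e q)

/-- The Gaussian curvature `-e^{-2u} Δu`, computed in the coordinate `e`. -/
def ConformalMetric.curvature (σ : ConformalMetric M S) (e : OpenPartialHomeomorph M ℂ)
    (q : M) : ℝ :=
  -(Laplacian.laplacian (σ.logDensity e ∘ e.symm) (e q) / σ.density e q)

/-- The metric is hyperbolic: its Gaussian curvature is `-1`. -/
def ConformalMetric.IsHyperbolic (σ : ConformalMetric M S) : Prop :=
  ∀ e, IsCoord e → ∀ q ∈ e.source \ S, σ.curvature e q = -1

/-- Conical singularity at `p` with cone angle `2πθ`: `u - (θ - 1) ln |z|` extends continuously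
to a neighbourhood of `p`. -/
def ConformalMetric.HasCone (σ : ConformalMetric M S) (p : M) (θ : ℝ) : Prop :=
  ∃ e : OpenPartialHomeomorph M ℂ, IsCenteredCoord S p e ∧
    ∃ h : M → ℝ, ContinuousOn h e.source ∧ ∀ q ∈ e.source \ {p},
      h q = σ.logDensity e q - (θ - 1) * Real.log ‖e q‖

/-- Cusp singularity at `p`: `u + ln |z| + ln (-ln |z|)` extends continuously to a neighbourhood
of `p`. -/
def ConformalMetric.HasCusp (σ : ConformalMetric M S) (p : M) : Prop :=
  ∃ e : OpenPartialHomeomorph M ℂ, IsCenteredCoord S p e ∧ (∀ q ∈ e.source, ‖e q‖ < 1) ∧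
    ∃ h : M → ℝ, ContinuousOn h e.source ∧ ∀ q ∈ e.source \ {p},
      h q = σ.logDensity e q + Real.log ‖e q‖ + Real.log (-Real.log ‖e q‖)

/-- The metric represents the divisor `D = ∑ (θ_p - 1) p`. -/
def ConformalMetric.Represents (D : M →₀ ℝ) (σ : ConformalMetric M (D.support : Set M)) : Prop :=
  ∀ p ∈ D.support, (-1 < D p → σ.HasCone p (1 + D p)) ∧ (D p = -1 → σ.HasCusp p)

/-- The metric is the pullback by (every branch of) `F` of the metric `lam(w) |dw|²`. -/
def ConformalMetric.IsPullback (σ : ConformalMetric M S) (F : MultivaluedFunction.{u, v} M S)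
    (lam : ℂ → ℝ) : Prop :=
  ∀ e, IsCoord e → ∀ (x : F.cover) (g : M → ℂ), (F.proj x : M) ∈ e.source → IsElement F x g →
    σ.density e (F.proj x) =
      lam (F.toFun x) * ‖deriv (g ∘ e.symm) (e (F.proj x))‖ ^ 2

/-- The local expressions of `F` at the conical points (`-1 < D p`) and at the cusps (`D p = -1`)
of the divisor, and: the pullback of `lam(w) |dw|²` by `F` is a (well defined, smooth) conformal
hyperbolic metric that represents `D`. -/
def LocalExpressions (D : M →₀ ℝ) (F : MultivaluedFunction.{u, v} M (D.support : Set M))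
    (lam : ℂ → ℝ) : Prop :=
  (∀ p ∈ D.support, -1 < D p → HasPowerForm F p (1 + D p)) ∧
  (∀ p ∈ D.support, D p = -1 → HasLogForm F p) ∧
  ∃ σ : ConformalMetric M (D.support : Set M),
    σ.IsPullback F lam ∧ σ.IsHyperbolic ∧ σ.Represents D

end

end HypSing

end

/-! The disk is reduced to the upper half-plane by the Cayley transform, an isometry that conjugates
`PSU11` into `PSL2R`.

Near a singular point put `ζ = log z`. Along a left half-plane covering the punctured neighbourhood,
`F` becomes a holomorphic locally univalent function `f` with positive imaginary part, and one turn
around the point gives `f (ζ + 2πi) = L f(ζ)` with `L` in `PSL2R`. The conjugacy type of `L` decides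
the shape of `f` (`hasModel_of_monodromy`). If `L` is elliptic or trivial, a Cayley transform makes
`f` bounded and turns `L` into multiplication by a unit number. After correction by a factor `exp (β
ζ)` the function is periodic, and the removable singularity theorem yields `exp (γ (ζ + κ (exp ζ)))`
with `γ > 0` and `κ` holomorphic at `0`. If `L` is parabolic, the same argument applied to the
exponential of a multiple of `f`, normalized so that `L` is a translation, yields `ζ + κ (exp ζ)` up
to a constant factor. If `L` were hyperbolic, a logarithm would turn it into a translation; the
parabolic normal form has unbounded imaginary part, while that of the logarithm stays below `π`.

The Schwarzian derivative only identifies the exponent: with respect to `ζ` it tends to `-θ² / 2` at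
the puncture, whereas the two models give `-γ² / 2` and `0` (`HasModel.of_tendsto_schwarzian`). No
differential equation is solved, and integral exponents need no separate treatment.

Finally `z exp (κ z)` is a coordinate with logarithm `ζ + κ (exp ζ)`; in it `F` is a power or a
logarithm and the pullback metric is explicit (`HasModel.exists_coord`). The metric is well defined
because `PSL2R` acts by isometries, and its curvature is `-1` because `-log (Im g) + log |g'|` has
Laplacian `|g'|² / (Im g)²`. -/

noncomputable section

namespace HypSing

universe u v

open Complex Filter ComplexConjugate

/-! ### Periodic holomorphic functions on a left half-plane -/

/-- A property valid near `0` holds at `exp ζ` once the real part of `ζ` is small enough. -/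
lemma exists_forall_exp_of_eventually {P : ℂ → Prop} (h : ∀ᶠ z in 𝓝 (0 : ℂ), P z) :
    ∃ c : ℝ, ∀ ζ : ℂ, ζ.re < c → P (exp ζ) := by
  obtain ⟨r, hr, hP⟩ := Metric.eventually_nhds_iff.1 h
  refine ⟨Real.log r, fun ζ hζ => hP ?_⟩
  rw [dist_zero_right, norm_exp]
  exact (Real.lt_log_iff_exp_lt hr).1 hζ

lemma exp_add_two_pi_mul_I (ζ : ℂ) : exp (ζ + 2 * Real.pi * I) = exp ζ := exp_periodic ζ

lemma add_two_pi_mul_I_re (ζ : ℂ) : (ζ + 2 * Real.pi * I).re = ζ.re := by simp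

lemma isOpen_leftHalfPlane (c : ℝ) : IsOpen {ζ : ℂ | ζ.re < c} :=
  isOpen_lt continuous_re continuous_const

lemma convex_leftHalfPlane (c : ℝ) : Convex ℝ {ζ : ℂ | ζ.re < c} := convex_halfSpace_re_lt c

/-- A bounded `2πi`-periodic holomorphic function on a left half-plane is a holomorphic function
of `exp ζ`, also at `0`. -/
theorem exists_eq_comp_exp {c B : ℝ} {k : ℂ → ℂ} (hk : DifferentiableOn ℂ k {ζ | ζ.re < c})
    (hper : ∀ ζ : ℂ, ζ.re < c → k (ζ + 2 * Real.pi * I) = k ζ)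
    (hB : ∀ ζ : ℂ, ζ.re < c → ‖k ζ‖ ≤ B) :
    ∃ K : ℂ → ℂ, AnalyticAt ℂ K 0 ∧ ∀ ζ : ℂ, ζ.re < c → k ζ = K (exp ζ) := by
  classical
  set H : Set ℂ := {ζ | ζ.re < c}
  -- Multiplication by `I` turns the period `2πi` into the real period `2π` and `Re ζ → -∞` into `Im
  -- z → ∞`, the setting of `cuspFunction`; extension by zero makes the periodicity global.
  set f : ℂ → ℂ := fun z => H.indicator k (I * z) with hf
  have hpi : (0 : ℝ) < 2 * Real.pi := by positivity
  have hre : ∀ z : ℂ, (I * z).re = -z.im := by intro z; simp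
  have hfper : Function.Periodic f (2 * Real.pi : ℝ) := by
    intro z
    have e1 : I * (z + (2 * Real.pi : ℝ)) = I * z + 2 * Real.pi * I := by push_cast; ring
    simp only [hf, e1]
    by_cases hz : I * z ∈ H
    · rw [indicator_of_mem hz, indicator_of_mem, hper _ hz]
      simpa [H] using hz
    · rw [indicator_of_notMem hz, indicator_of_notMem]
      simpa [H] using hz
  have hev : ∀ᶠ z : ℂ in comap im atTop, I * z ∈ H := by
    filter_upwards [preimage_mem_comap (Ioi_mem_atTop (-c))] with z hz
    change (I * z).re < c
    rw [hre]; simp only [mem_preimage, mem_Ioi] at hz; linarith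
  have hhol : ∀ᶠ z in comap im atTop, DifferentiableAt ℂ f z := by
    filter_upwards [hev] with z hz
    have h1 : H ∈ 𝓝 (I * z) := (isOpen_leftHalfPlane c).mem_nhds hz
    have h2 : DifferentiableAt ℂ (H.indicator k) (I * z) :=
      (hk.differentiableAt h1).congr_of_eventuallyEq
        (by filter_upwards [h1] with w hw using indicator_of_mem hw k)
    exact h2.comp z (differentiableAt_id.const_mul I)
  have hbd : BoundedAtFilter (comap im atTop) f := by
    refine Asymptotics.IsBigO.of_bound B ?_
    filter_upwards [hev] with z hz
    simp only [hf, indicator_of_mem hz, Pi.one_apply, norm_one, mul_one]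
    exact hB _ hz
  refine ⟨Function.Periodic.cuspFunction (2 * Real.pi) f, ?_, ?_⟩
  · rw [analyticAt_iff_eventually_differentiableAt]
    -- Boundedness removes the singularity at `0`.
    have h0 := Function.Periodic.differentiableAt_cuspFunction_zero hpi hfper hhol hbd
    have h1 := Function.Periodic.eventually_differentiableAt_cuspFunction_nhds_ne_zero hpi hfper
      hhol
    rw [eventually_nhdsWithin_iff] at h1
    filter_upwards [h1] with z hz
    by_cases hz0 : z = 0
    · rwa [hz0]
    · exact hz hz0
  · intro ζ hζ
    have h1 := Function.Periodic.eq_cuspFunction hpi.ne' hfper (-I * ζ)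
    have h2 : Function.Periodic.qParam (2 * Real.pi) (-I * ζ) = exp ζ := by
      unfold Function.Periodic.qParam
      congr 1
      have : (Real.pi : ℂ) ≠ 0 := ofReal_ne_zero.2 Real.pi_ne_zero
      push_cast
      field_simp
      linear_combination (-ζ) * I_sq
    have h3 : I * (-I * ζ) = ζ := by linear_combination (-ζ) * I_sq
    rw [h2] at h1
    rw [h1]
    simp only [hf, h3]
    exact (indicator_of_mem (s := H) hζ k).symm

/-- Once the zero of finite order is split off, the remaining factor `g` has a logarithm near `0`.
Division by `g 0` brings its value to `1`, where the principal branch is analytic. -/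
lemma AnalyticAt.exists_eq_pow_mul_exp {K : ℂ → ℂ} (hK : AnalyticAt ℂ K 0)
    (h0 : ¬ ∀ᶠ z in 𝓝 (0 : ℂ), K z = 0) :
    ∃ (n : ℕ) (l : ℂ → ℂ), AnalyticAt ℂ l 0 ∧ ∀ᶠ z in 𝓝 (0 : ℂ), K z = z ^ n * exp (l z) := by
  obtain ⟨n, g, hg, hg0, hKg⟩ := hK.exists_eventuallyEq_pow_smul_nonzero_iff.2 h0
  refine ⟨n, fun z => log (g z / g 0) + log (g 0), ?_, ?_⟩
  · refine AnalyticAt.add (AnalyticAt.clog (hg.div analyticAt_const hg0) ?_) analyticAt_const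
    simp [hg0, one_mem_slitPlane]
  · filter_upwards [hKg, hg.continuousAt.eventually_ne hg0] with z hz hz0
    rw [hz, exp_add, exp_log (div_ne_zero hz0 hg0), exp_log hg0]
    simp [div_mul_cancel₀ _ hg0]

/-- A bounded `2πi`-periodic holomorphic function on a left half-plane that does not vanish
identically is `exp (n ζ + l (exp ζ))` far to the left. -/
theorem exists_eq_exp_of_periodic {c B : ℝ} {k : ℂ → ℂ}
    (hk : DifferentiableOn ℂ k {ζ | ζ.re < c})
    (hper : ∀ ζ : ℂ, ζ.re < c → k (ζ + 2 * Real.pi * I) = k ζ)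
    (hB : ∀ ζ : ℂ, ζ.re < c → ‖k ζ‖ ≤ B) (h0 : ∀ c' : ℝ, ∃ ζ : ℂ, ζ.re < c' ∧ k ζ ≠ 0) :
    ∃ (n : ℕ) (l : ℂ → ℂ) (c' : ℝ), AnalyticAt ℂ l 0 ∧ c' ≤ c ∧
      ∀ ζ : ℂ, ζ.re < c' → k ζ = exp (n * ζ + l (exp ζ)) := by
  obtain ⟨K, hK, hkK⟩ := exists_eq_comp_exp hk hper hB
  have hK0 : ¬ ∀ᶠ z in 𝓝 (0 : ℂ), K z = 0 := by
    intro h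
    obtain ⟨c', hc'⟩ := exists_forall_exp_of_eventually h
    obtain ⟨ζ, hζ, hne⟩ := h0 (min c c')
    exact hne ((hkK ζ (hζ.trans_le (min_le_left _ _))).trans
      (hc' ζ (hζ.trans_le (min_le_right _ _))))
  obtain ⟨n, l, hl, h⟩ := AnalyticAt.exists_eq_pow_mul_exp hK hK0
  obtain ⟨c', hc'⟩ := exists_forall_exp_of_eventually h
  refine ⟨n, l, min c c', hl, min_le_left _ _, fun ζ hζ => ?_⟩
  rw [hkK ζ (hζ.trans_le (min_le_left _ _)), hc' ζ (hζ.trans_le (min_le_right _ _)), exp_add,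
    ← exp_nat_mul]

/-- The filter `comap re atBot` stands for the approach to the puncture in the variable `ζ = log z`.
-/
lemma tendsto_exp_comap_re : Tendsto exp (comap re atBot) (𝓝 0) := by
  rw [comap_exp_nhds_zero.symm]; exact tendsto_comap

lemma eventually_re_lt (c : ℝ) : ∀ᶠ ζ : ℂ in comap re atBot, ζ.re < c :=
  preimage_mem_comap (Iio_mem_atBot c)

instance neBot_comap_re : (comap re atBot : Filter ℂ).NeBot :=
  NeBot.comap_of_surj inferInstance re_surjective

/-! ### Normal forms for rotations and translations, exclusion of dilations -/

/-- A holomorphic function into the disk on a left half-plane that is multiplied by a unit complex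
number under the translation by `2πi` is a power of a local coordinate in `exp ζ`. -/
theorem exists_eq_exp_mul_of_rotation {c : ℝ} {g : ℂ → ℂ} {μ : ℂ}
    (hg : DifferentiableOn ℂ g {ζ | ζ.re < c}) (hg1 : ∀ ζ : ℂ, ζ.re < c → ‖g ζ‖ < 1)
    (hg' : ∀ ζ : ℂ, ζ.re < c → deriv g ζ ≠ 0) (hμ : ‖μ‖ = 1)
    (hper : ∀ ζ : ℂ, ζ.re < c → g (ζ + 2 * Real.pi * I) = μ * g ζ)
    (hμ1 : μ = 1 → Tendsto g (comap re atBot) (𝓝 0)) :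
    ∃ (γ : ℝ) (κ : ℂ → ℂ) (c' : ℝ), 0 < γ ∧ AnalyticAt ℂ κ 0 ∧ c' ≤ c ∧
      ∀ ζ : ℂ, ζ.re < c' → g ζ = exp (γ * (ζ + κ (exp ζ))) := by
  have hpi : (Real.pi : ℂ) ≠ 0 := ofReal_ne_zero.2 Real.pi_ne_zero
  -- The factor `exp (β ζ)` cancels the multiplier `μ`. Taking `β` as a fractional part serves
  -- twice: `0 ≤ β` keeps this factor bounded to the left, and `β < 1` makes `n - β` positive as
  -- soon as `n ≥ 1`.
  obtain ⟨β, hβ0, hβ1, hβμ⟩ : ∃ β : ℝ, 0 ≤ β ∧ β < 1 ∧ μ * exp (β * (2 * Real.pi * I)) = 1 := by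
    have hμ0 : μ ≠ 0 := fun h => by simp [h] at hμ
    have key : μ * exp (((-arg μ : ℝ) / (2 * Real.pi) : ℝ) * (2 * Real.pi * I)) = 1 := by
      have h1 : (((-arg μ : ℝ) / (2 * Real.pi) : ℝ) * (2 * Real.pi * I) : ℂ) = -(arg μ * I) := by
        push_cast; field_simp
      have h2 := norm_mul_exp_arg_mul_I μ
      rw [hμ, ofReal_one, one_mul] at h2
      rw [h1, exp_neg, h2, mul_inv_cancel₀ hμ0]
    refine ⟨Int.fract ((-arg μ : ℝ) / (2 * Real.pi)), Int.fract_nonneg _, Int.fract_lt_one _, ?_⟩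
    rw [Int.fract]
    push_cast at key ⊢
    rw [sub_mul, exp_sub, exp_int_mul_two_pi_mul_I, div_one]
    exact key
  have hkd : DifferentiableOn ℂ (fun ζ => g ζ * exp (β * ζ)) {ζ | ζ.re < c} :=
    hg.mul (by fun_prop)
  have hknorm : ∀ ζ : ℂ, ζ.re < c → ‖g ζ * exp (β * ζ)‖ ≤ Real.exp (β * ζ.re) := by
    intro ζ hζ
    rw [norm_mul, norm_exp]
    simp only [re_ofReal_mul]
    exact mul_le_of_le_one_left (Real.exp_pos _).le (hg1 ζ hζ).le
  obtain ⟨n, l, c', hl, hc', hkl⟩ := exists_eq_exp_of_periodic (B := Real.exp (β * c)) hkd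
    (fun ζ hζ => by
      rw [hper ζ hζ, mul_add, exp_add]
      linear_combination (g ζ * exp (β * ζ)) * hβμ)
    (fun ζ hζ => (hknorm ζ hζ).trans (Real.exp_le_exp.2 (mul_le_mul_of_nonneg_left hζ.le hβ0)))
    (by
      intro c'
      by_contra! hcon
      have hmem : min c c' - 1 < min c c' := by linarith
      set ζ₀ : ℂ := ((min c c' - 1 : ℝ) : ℂ)
      have hζ₀ : ζ₀.re < min c c' := by simpa [ζ₀] using hmem
      refine hg' ζ₀ (hζ₀.trans_le (min_le_left _ _)) ?_
      have : g =ᶠ[𝓝 ζ₀] fun _ => 0 := by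
        filter_upwards [(isOpen_leftHalfPlane _).mem_nhds hζ₀] with ζ hζ
        have := hcon ζ (lt_of_lt_of_le hζ (min_le_right _ _))
        simpa [exp_ne_zero] using this
      rw [this.deriv_eq]; simp)
  have hgl : ∀ ζ : ℂ, ζ.re < c' → g ζ = exp ((n - β) * ζ + l (exp ζ)) := by
    intro ζ hζ
    have h1 := hkl ζ hζ
    have h2 : g ζ = (g ζ * exp (β * ζ)) * exp (-(β * ζ)) := by
      rw [mul_assoc, ← exp_add]; simp
    rw [h2, h1, ← exp_add]
    congr 1; ring
  -- For `n = 0` the product `g ζ * exp (β ζ)` would tend to `exp (l 0) ≠ 0`. It tends to `0`: for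
  -- `β > 0` because `g` is bounded, and for `β = 0` because then `μ = 1` and `hμ1` applies.
  have hn : n ≠ 0 := by
    rintro rfl
    have hlim1 : Tendsto (fun ζ : ℂ => exp (l (exp ζ))) (comap re atBot) (𝓝 (exp (l 0))) :=
      (continuous_exp.tendsto _).comp (hl.continuousAt.tendsto.comp tendsto_exp_comap_re)
    have hlim2 : Tendsto (fun ζ : ℂ => exp (l (exp ζ))) (comap re atBot) (𝓝 0) := by
      rcases hβ0.eq_or_lt with hβ | hβ
      · have hμ' : μ = 1 := by simpa [← hβ] using hβμ
        refine (hμ1 hμ').congr' ?_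
        filter_upwards [eventually_re_lt c'] with ζ hζ
        rw [hgl ζ hζ]; simp [← hβ]
      · have : Tendsto (fun ζ : ℂ => Real.exp (β * ζ.re)) (comap re atBot) (𝓝 0) :=
          Real.tendsto_exp_atBot.comp ((tendsto_id.const_mul_atBot hβ).comp tendsto_comap)
        refine squeeze_zero_norm' ?_ this
        filter_upwards [eventually_re_lt c'] with ζ hζ
        have := hknorm ζ (hζ.trans_le hc')
        rw [hkl ζ hζ] at this
        simpa using this
    exact exp_ne_zero _ (tendsto_nhds_unique hlim1 hlim2)
  have hγ : (0 : ℝ) < n - β := by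
    have : (1 : ℝ) ≤ n := by exact_mod_cast Nat.one_le_iff_ne_zero.2 hn
    linarith
  have hγ' : ((n : ℂ) - β) ≠ 0 := by exact_mod_cast hγ.ne'
  refine ⟨n - β, fun z => l z / (n - β), c', hγ, hl.div analyticAt_const hγ', hc', fun ζ hζ => ?_⟩
  rw [hgl ζ hζ]
  congr 1
  push_cast
  field_simp

/-- A holomorphic function into the upper half-plane on a left half-plane that is translated by
`b ≠ 0` under the translation by `2πi` is the logarithm of a local coordinate in `exp ζ`. -/
theorem exists_eq_of_translation {c b : ℝ} {h : ℂ → ℂ}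
    (hh : DifferentiableOn ℂ h {ζ | ζ.re < c}) (him : ∀ ζ : ℂ, ζ.re < c → 0 < (h ζ).im)
    (hb : b ≠ 0) (hper : ∀ ζ : ℂ, ζ.re < c → h (ζ + 2 * Real.pi * I) = h ζ + b) :
    0 < b ∧ ∃ (κ : ℂ → ℂ) (c' : ℝ), AnalyticAt ℂ κ 0 ∧ c' ≤ c ∧
      ∀ ζ : ℂ, ζ.re < c' → 2 * Real.pi * I * h ζ = b * (ζ + κ (exp ζ)) := by
  have hpi : (Real.pi : ℂ) ≠ 0 := ofReal_ne_zero.2 Real.pi_ne_zero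
  have hbabs : 0 < |b| := abs_pos.2 hb
  have hbabsC : ((|b| : ℝ) : ℂ) ≠ 0 := ofReal_ne_zero.2 hbabs.ne'
  -- The sign of `b` is not known yet. Dividing by `|b|` instead of `b` ensures `Re H ≤ 0`, so that
  -- `exp ∘ H` is bounded.
  obtain ⟨s, hs, hsb⟩ : ∃ s : ℤ, (s = 1 ∨ s = -1) ∧ b = s * |b| := by
    rcases hb.lt_or_gt with h | h
    · exact ⟨-1, Or.inr rfl, by rw [abs_of_neg h]; simp⟩
    · exact ⟨1, Or.inl rfl, by rw [abs_of_pos h]; simp⟩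
  have hsb' : (b : ℂ) = s * (|b| : ℝ) := by exact_mod_cast hsb
  set H : ℂ → ℂ := fun ζ => 2 * Real.pi * I * h ζ / (|b| : ℝ) with hH
  have hHd : DifferentiableOn ℂ H {ζ | ζ.re < c} := (hh.const_mul _).div_const _
  have hHper : ∀ ζ : ℂ, ζ.re < c → H (ζ + 2 * Real.pi * I) = H ζ + s * (2 * Real.pi * I) := by
    intro ζ hζ
    simp only [hH]
    rw [hper ζ hζ, hsb']
    field_simp
  obtain ⟨n, l, c', hl, hc', hkl⟩ := exists_eq_exp_of_periodic (B := 1) (k := fun ζ => exp (H ζ))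
    hHd.cexp
    (fun ζ hζ => by
      rw [hHper ζ hζ, exp_add, exp_int_mul_two_pi_mul_I, mul_one])
    (fun ζ hζ => by
      rw [norm_exp, Real.exp_le_one_iff]
      have : (H ζ).re = -(2 * Real.pi * (h ζ).im / |b|) := by
        simp only [hH]
        rw [div_ofReal_re]
        simp
        ring
      rw [this]
      have := him ζ hζ
      have := Real.pi_pos
      rw [Left.neg_nonpos_iff]
      positivity)
    (fun c' => ⟨((c' - 1 : ℝ) : ℂ), by simp, exp_ne_zero _⟩)
  obtain ⟨r, hr, hlr⟩ := Metric.eventually_nhds_iff.1 hl.eventually_analyticAt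
  set c₁ := min c' (Real.log r)
  have hc₁ : ∀ ζ : ℂ, ζ.re < c₁ → AnalyticAt ℂ l (exp ζ) := by
    intro ζ hζ
    apply hlr
    rw [dist_zero_right, norm_exp]
    exact (Real.lt_log_iff_exp_lt hr).1 (lt_of_lt_of_le hζ (min_le_right _ _))
  -- Two logarithms of the same function: `exp (d ζ) = 1`, so `d` has zero derivative and is
  -- constant on the half-plane.
  set d : ℂ → ℂ := fun ζ => H ζ - (n * ζ + l (exp ζ)) with hd
  have hdd : DifferentiableOn ℂ d {ζ | ζ.re < c₁} := by
    refine (hHd.mono fun ζ hζ => ?_).sub (DifferentiableOn.add (by fun_prop) ?_)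
    · exact lt_of_lt_of_le hζ ((min_le_left _ _).trans hc')
    · intro ζ hζ
      exact ((hc₁ ζ hζ).differentiableAt.comp ζ differentiableAt_exp).differentiableWithinAt
  have hdexp : ∀ ζ : ℂ, ζ.re < c₁ → exp (d ζ) = 1 := by
    intro ζ hζ
    simp only [hd]
    rw [exp_sub, hkl ζ (lt_of_lt_of_le hζ (min_le_left _ _)), div_self (exp_ne_zero _)]
  have hd0 : EqOn (deriv d) 0 {ζ | ζ.re < c₁} := by
    intro ζ hζ
    have h1 : (fun ζ => exp (d ζ)) =ᶠ[𝓝 ζ] fun _ => 1 := by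
      filter_upwards [(isOpen_leftHalfPlane c₁).mem_nhds hζ] with w hw using hdexp w hw
    have h2 := ((hdd.differentiableAt ((isOpen_leftHalfPlane c₁).mem_nhds hζ)).hasDerivAt).cexp
    have h3 := h2.deriv
    rw [h1.deriv_eq, deriv_const] at h3
    rcases mul_eq_zero.1 h3.symm with h4 | h4
    · exact absurd h4 (exp_ne_zero _)
    · exact h4
  set ζ₀ : ℂ := ((c₁ - 1 : ℝ) : ℂ)
  have hζ₀ : ζ₀.re < c₁ := by simp [ζ₀]
  have hconst : ∀ ζ : ℂ, ζ.re < c₁ → d ζ = d ζ₀ := fun ζ hζ =>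
    (isOpen_leftHalfPlane c₁).is_const_of_deriv_eq_zero
      (convex_leftHalfPlane c₁).isPreconnected hdd hd0 hζ hζ₀
  -- Under the translation by `2πi` the terms `H ζ` and `n ζ` grow by `s` and `n` times `2πi`, while
  -- `d` is constant. Since `n` is a natural number, this determines the sign `s = 1`.
  have hns : (n : ℂ) = s := by
    have h1 := hconst (ζ₀ + 2 * Real.pi * I) (by rwa [add_two_pi_mul_I_re])
    simp only [hd] at h1
    rw [hHper ζ₀ (hζ₀.trans_le ((min_le_left _ _).trans hc')), exp_add_two_pi_mul_I] at h1
    have h2 : ((s : ℂ) - n) * (2 * Real.pi * I) = 0 := by linear_combination h1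
    rcases mul_eq_zero.1 h2 with h3 | h3
    · exact (sub_eq_zero.1 h3).symm
    · exact absurd h3 two_pi_I_ne_zero
  have hns' : (n : ℤ) = s := by exact_mod_cast hns
  have hs1 : s = 1 := by rcases hs with h | h <;> omega
  have hbpos : 0 < b := by rw [hsb, hs1]; simpa using hb
  refine ⟨hbpos, fun z => l z + d ζ₀, c₁, hl.add analyticAt_const, (min_le_left _ _).trans hc',
    fun ζ hζ => ?_⟩
  have h1 := hconst ζ hζ
  rw [← h1]
  simp only [hd, hns, hs1, hH]
  rw [abs_of_pos hbpos] at hbabsC ⊢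
  push_cast
  field_simp
  ring

/-- There is no holomorphic function into the upper half-plane on a left half-plane that is
transformed by a hyperbolic affine map under the translation by `2πi`. -/
theorem false_of_dilation {c b l : ℝ} {h : ℂ → ℂ}
    (hh : DifferentiableOn ℂ h {ζ | ζ.re < c}) (him : ∀ ζ : ℂ, ζ.re < c → 0 < (h ζ).im)
    (hl : 0 < l) (hl1 : l ≠ 1)
    (hper : ∀ ζ : ℂ, ζ.re < c → h (ζ + 2 * Real.pi * I) = l * h ζ + b) : False := by
  have hpi := Real.pi_pos
  have hl1' : (l : ℂ) - 1 ≠ 0 := sub_ne_zero.2 (by exact_mod_cast hl1)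
  -- The fixed point of `w ↦ l w + b` is `-t`, so `h + t` is multiplied by `l` and its logarithm is
  -- translated by `log l`.
  set t : ℝ := b / (l - 1) with ht
  have htC : (t : ℂ) * (l - 1) = b := by rw [ht]; push_cast; field_simp
  have him' : ∀ ζ : ℂ, ζ.re < c → 0 < (h ζ + t).im := fun ζ hζ => by simpa using him ζ hζ
  have hlogim : ∀ ζ : ℂ, ζ.re < c → 0 < (log (h ζ + t)).im ∧ (log (h ζ + t)).im < Real.pi := by
    intro ζ hζ
    rw [log_im]
    refine ⟨lt_of_le_of_ne (arg_nonneg_iff.2 (him' ζ hζ).le) fun h0 => ?_,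
      lt_of_le_of_ne (arg_le_pi _) fun h0 => ?_⟩
    · exact (him' ζ hζ).ne' (arg_eq_zero_iff.1 h0.symm).2
    · exact (him' ζ hζ).ne' (arg_eq_pi_iff.1 h0).2
  obtain ⟨hpos, κ, c', hκ, hc', hκeq⟩ := exists_eq_of_translation (b := Real.log l)
    (h := fun ζ => log (h ζ + t)) (c := c)
    ((hh.add_const _).clog fun ζ hζ => Or.inr (him' ζ hζ).ne')
    (fun ζ hζ => (hlogim ζ hζ).1) (Real.log_ne_zero_of_pos_of_ne_one hl hl1)
    (fun ζ hζ => by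
      have : h (ζ + 2 * Real.pi * I) + t = l * (h ζ + t) := by
        rw [hper ζ hζ]; linear_combination -htC
      rw [this, log_ofReal_mul hl (fun h0 => (him' ζ hζ).ne' (by simp [h0]))]
      ring)
  -- By the normal form, `-2π` times the imaginary part of `log (h ζ + t)` equals `log l` times this
  -- sum, which tends to `-∞`; but the imaginary part is less than `π`.
  have h1 : Tendsto (fun ζ : ℂ => ζ.re + (κ (exp ζ)).re) (comap re atBot) atBot :=
    tendsto_atBot_add_right_of_ge'  _ ((κ 0).re + 1) tendsto_comap (by
      have h2 : Tendsto (fun ζ : ℂ => (κ (exp ζ)).re) (comap re atBot) (𝓝 (κ 0).re) :=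
        (continuous_re.tendsto _).comp (hκ.continuousAt.tendsto.comp tendsto_exp_comap_re)
      filter_upwards [h2.eventually (gt_mem_nhds (lt_add_one _))] with ζ hζ using hζ.le)
  obtain ⟨ζ, hζ1, hζ2⟩ := ((h1.eventually (eventually_lt_atBot
    (-(2 * Real.pi * Real.pi / Real.log l)))).and (eventually_re_lt c')).exists
  have h3 := congrArg re (hκeq ζ hζ2)
  have h4 : (2 * Real.pi * I * log (h ζ + t)).re = -(2 * Real.pi * (log (h ζ + t)).im) := by
    simp
  rw [h4, re_ofReal_mul, add_re] at h3
  have h5 := (hlogim ζ (hζ2.trans_le hc')).2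
  have h6 : Real.log l * (ζ.re + (κ (exp ζ)).re) < -(2 * Real.pi * Real.pi) := by
    have := mul_lt_mul_of_pos_left hζ1 hpos
    have h7 : Real.log l * -(2 * Real.pi * Real.pi / Real.log l) = -(2 * Real.pi * Real.pi) := by
      field_simp
    linarith
  nlinarith

/-! ### Local models and their classification by monodromy -/

/-- `|g'|²` times the density of the disk metric for `g = exp (γ ω)`, `|ω'| = 1`, `t = Re ω`. -/
def coneProfile (γ t : ℝ) : ℝ := (2 * γ * Real.exp (γ * t) / (1 - Real.exp (γ * t) ^ 2)) ^ 2

/-- Density of the hyperbolic metric of the left half-plane at a point of real part `t`. -/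
def cuspProfile (t : ℝ) : ℝ := 1 / t ^ 2

/-- Far to the left, `f` is up to a fractional linear transformation of the form `Φ ∘ ω`, where
`ω ζ = ζ + κ (exp ζ)`, and pulls back the metric of the upper half-plane to `Ψ (Re ω) |dω|²`. -/
def HasModel (Φ : ℂ → ℂ) (Ψ : ℝ → ℝ) (f : ℂ → ℂ) : Prop :=
  ∃ (κ : ℂ → ℂ) (c : ℝ) (T : GL (Fin 2) ℂ), AnalyticAt ℂ κ 0 ∧ ∀ ζ : ℂ, ζ.re < c →
    T • (f ζ : OnePoint ℂ) = (Φ (ζ + κ (exp ζ)) : OnePoint ℂ) ∧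
    halfPlaneDensity (f ζ) * ‖deriv f ζ‖ ^ 2 =
      Ψ (ζ + κ (exp ζ)).re * ‖deriv (fun w => w + κ (exp w)) ζ‖ ^ 2

/-- Cross-multiplication gives a form suited to the identity theorem and to `linear_combination`;
the inequality says that the image is not `∞`. -/
lemma smul_coe_eq_coe_iff {L : GL (Fin 2) ℂ} {w w' : ℂ} :
    L • (w : OnePoint ℂ) = (w' : OnePoint ℂ) ↔
      L 1 0 * w + L 1 1 ≠ 0 ∧ L 0 0 * w + L 0 1 = w' * (L 1 0 * w + L 1 1) := by
  rw [OnePoint.smul_some_eq_ite]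
  split_ifs with h
  · simp [h]
  · simp only [OnePoint.coe_eq_coe, h, ne_eq, not_false_eq_true, true_and]
    rw [div_eq_iff h]

/-- Construction of an element of `GL(2,ℂ)` with given entries. -/
lemma exists_gl_entries (a b c d : ℂ) (h : a * d - b * c ≠ 0) :
    ∃ L : GL (Fin 2) ℂ, L 0 0 = a ∧ L 0 1 = b ∧ L 1 0 = c ∧ L 1 1 = d :=
  ⟨Matrix.GeneralLinearGroup.mkOfDetNeZero !![a, b; c, d] (by rwa [Matrix.det_fin_two_of]),
    rfl, rfl, rfl, rfl⟩

lemma hasDerivAt_moebius {f : ℂ → ℂ} {f' z : ℂ} (a b c d : ℂ) (hf : HasDerivAt f f' z)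
    (h : c * f z + d ≠ 0) :
    HasDerivAt (fun w => (a * f w + b) / (c * f w + d))
      ((a * d - b * c) * f' / (c * f z + d) ^ 2) z := by
  refine (((hf.const_mul a).add_const b).div ((hf.const_mul c).add_const d) h).congr_deriv ?_
  ring

lemma im_pos_ne_conj {w τ : ℂ} (hw : 0 < w.im) (hτ : 0 < τ.im) : w - conj τ ≠ 0 := by
  intro h
  have := congrArg im h
  simp at this
  linarith

/-- Divided by `‖w - conj τ‖ ^ 2`, this computes `1 - |C w|²` for the Cayley transform `C` centered
at `τ`. Both the inclusion in the disk and the isometry property follow from it. -/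
lemma normSq_cayley_identity (w τ : ℂ) :
    ‖w - conj τ‖ ^ 2 - ‖w - τ‖ ^ 2 = 4 * (w.im * τ.im) := by
  rw [← normSq_eq_norm_sq, ← normSq_eq_norm_sq, normSq_apply, normSq_apply]
  simp
  ring

lemma norm_cayley_lt_one {w τ : ℂ} (hw : 0 < w.im) (hτ : 0 < τ.im) :
    ‖(w - τ) / (w - conj τ)‖ < 1 := by
  have h0 := im_pos_ne_conj hw hτ
  rw [norm_div, div_lt_one (norm_pos_iff.2 h0)]
  have := normSq_cayley_identity w τ
  have h1 : 0 < w.im * τ.im := mul_pos hw hτ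
  exact lt_of_pow_lt_pow_left₀ 2 (norm_nonneg _) (by linarith)

lemma hasDerivAt_cayley {f : ℂ → ℂ} {f' z τ : ℂ} (hf : HasDerivAt f f' z) (hw : 0 < (f z).im)
    (hτ : 0 < τ.im) :
    HasDerivAt (fun w => (f w - τ) / (f w - conj τ))
      ((τ - conj τ) * f' / (f z - conj τ) ^ 2) z := by
  have h := hasDerivAt_moebius 1 (-τ) 1 (-conj τ) hf
    (by simpa [sub_eq_add_neg] using im_pos_ne_conj hw hτ)
  simp only [one_mul, ← sub_eq_add_neg] at h
  convert h using 1
  congr 2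
  ring

/-- The Cayley transform is an isometry from the upper half-plane to the disk. -/
lemma diskDensity_cayley {w τ w' : ℂ} (hw : 0 < w.im) (hτ : 0 < τ.im) :
    diskDensity ((w - τ) / (w - conj τ)) * ‖(τ - conj τ) * w' / (w - conj τ) ^ 2‖ ^ 2 =
      halfPlaneDensity w * ‖w'‖ ^ 2 := by
  have h0 := norm_pos_iff.2 (im_pos_ne_conj hw hτ)
  have h1 : ‖w - τ‖ ^ 2 = ‖w - conj τ‖ ^ 2 - 4 * (w.im * τ.im) := by
    linarith [normSq_cayley_identity w τ]
  have h2 : ‖τ - conj τ‖ = 2 * τ.im := by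
    rw [sub_conj, norm_mul, norm_I, mul_one, norm_real, Real.norm_of_nonneg (by positivity)]
  simp only [diskDensity, halfPlaneDensity, norm_div, norm_mul, norm_pow, div_pow, h1, h2]
  have h3 : 1 - (‖w - conj τ‖ ^ 2 - 4 * (w.im * τ.im)) / ‖w - conj τ‖ ^ 2 =
      4 * (w.im * τ.im) / ‖w - conj τ‖ ^ 2 := by field_simp; ring
  rw [h3]
  field_simp
  ring

lemma eventually_differentiableAt_add_comp_exp {κ : ℂ → ℂ} (hκ : AnalyticAt ℂ κ 0) :
    ∃ c : ℝ, ∀ ζ : ℂ, ζ.re < c → DifferentiableAt ℂ (fun w => w + κ (exp w)) ζ := by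
  obtain ⟨c, hc⟩ := exists_forall_exp_of_eventually hκ.eventually_analyticAt
  exact ⟨c, fun ζ hζ => differentiableAt_id.add
    ((hc ζ hζ).differentiableAt.comp ζ differentiableAt_exp)⟩

/-- The case in which the translation by `2πi` acts by a rotation around a point `τ`. -/
theorem hasModel_of_rotation {c : ℝ} {f : ℂ → ℂ} {μ τ : ℂ}
    (hf : DifferentiableOn ℂ f {ζ | ζ.re < c}) (him : ∀ ζ : ℂ, ζ.re < c → 0 < (f ζ).im)
    (hf' : ∀ ζ : ℂ, ζ.re < c → deriv f ζ ≠ 0) (hμ : ‖μ‖ = 1) (hτ : 0 < τ.im)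
    (hper : ∀ ζ : ℂ, ζ.re < c → (f (ζ + 2 * Real.pi * I) - τ) / (f (ζ + 2 * Real.pi * I) - conj τ) =
      μ * ((f ζ - τ) / (f ζ - conj τ)))
    (hμ1 : μ = 1 → Tendsto f (comap re atBot) (𝓝 τ)) :
    ∃ γ : ℝ, 0 < γ ∧ HasModel (fun w => exp (γ * w)) (coneProfile γ) f := by
  have hττ : τ - conj τ ≠ 0 := im_pos_ne_conj hτ hτ
  have hfd : ∀ ζ : ℂ, ζ.re < c → HasDerivAt f (deriv f ζ) ζ := fun ζ hζ =>
    (hf.differentiableAt ((isOpen_leftHalfPlane c).mem_nhds hζ)).hasDerivAt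
  set g : ℂ → ℂ := fun ζ => (f ζ - τ) / (f ζ - conj τ) with hg
  have hgd : ∀ ζ : ℂ, ζ.re < c → HasDerivAt g
      ((τ - conj τ) * deriv f ζ / (f ζ - conj τ) ^ 2) ζ := fun ζ hζ =>
    hasDerivAt_cayley (hfd ζ hζ) (him ζ hζ) hτ
  obtain ⟨γ, κ, c₁, hγ, hκ, hc₁, hgκ⟩ := exists_eq_exp_mul_of_rotation (g := g) (μ := μ) (c := c)
    (fun ζ hζ => (hgd ζ hζ).differentiableAt.differentiableWithinAt)
    (fun ζ hζ => norm_cayley_lt_one (him ζ hζ) hτ)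
    (fun ζ hζ => by
      rw [(hgd ζ hζ).deriv]
      exact div_ne_zero (mul_ne_zero hττ (hf' ζ hζ))
        (pow_ne_zero _ (im_pos_ne_conj (him ζ hζ) hτ)))
    hμ hper (fun h => by
      have := ((hμ1 h).sub_const τ).div ((hμ1 h).sub_const (conj τ)) hττ
      rwa [sub_self, zero_div] at this)
  obtain ⟨c₂, hc₂⟩ := eventually_differentiableAt_add_comp_exp hκ
  obtain ⟨T, hT⟩ := exists_gl_entries 1 (-τ) 1 (-conj τ) (by
    have : (1 : ℂ) * -conj τ - -τ * 1 = τ - conj τ := by ring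
    rwa [this])
  refine ⟨γ, hγ, κ, min c₁ c₂, T, hκ, fun ζ hζ => ?_⟩
  have hζ1 : ζ.re < c₁ := hζ.trans_le (min_le_left _ _)
  have hζc := hζ1.trans_le hc₁
  have hne := im_pos_ne_conj (him ζ hζc) hτ
  constructor
  · rw [smul_coe_eq_coe_iff, hT.1, hT.2.1, hT.2.2.1, hT.2.2.2]
    beta_reduce
    rw [← hgκ ζ hζ1]
    simp only [one_mul, ← sub_eq_add_neg, hg]
    exact ⟨hne, (div_mul_cancel₀ _ hne).symm⟩
  · set η : ℂ → ℂ := fun w => w + κ (exp w) with hη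
    have hηd : HasDerivAt η (deriv η ζ) ζ :=
      (hc₂ ζ (hζ.trans_le (min_le_right _ _))).hasDerivAt
    have h1 : HasDerivAt g (exp (γ * η ζ) * (γ * deriv η ζ)) ζ := by
      refine ((hηd.const_mul (γ : ℂ)).cexp).congr_of_eventuallyEq ?_
      filter_upwards [(isOpen_leftHalfPlane c₁).mem_nhds hζ1] with w hw using hgκ w hw
    -- The density is computed in the disk, where `g = exp (γ η)` has norm `exp (γ Re η)` and `‖g'‖
    -- = γ ‖g‖ ‖η'‖`.
    rw [← diskDensity_cayley (him ζ hζc) hτ, ← (hgd ζ hζc).deriv, h1.deriv]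
    change diskDensity (g ζ) * _ = coneProfile γ (η ζ).re * _
    have h2 : g ζ = exp (γ * η ζ) := hgκ ζ hζ1
    rw [h2, diskDensity, coneProfile]
    simp only [norm_mul, norm_exp, re_ofReal_mul, norm_real, Real.norm_of_nonneg hγ.le]
    rw [div_pow]
    ring

/-- The case in which the translation by `2πi` acts by a translation. -/
theorem hasModel_of_translation {c b : ℝ} {h : ℂ → ℂ}
    (hh : DifferentiableOn ℂ h {ζ | ζ.re < c}) (him : ∀ ζ : ℂ, ζ.re < c → 0 < (h ζ).im)
    (hb : b ≠ 0) (hper : ∀ ζ : ℂ, ζ.re < c → h (ζ + 2 * Real.pi * I) = h ζ + b) :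
    HasModel (fun w => w) cuspProfile h := by
  obtain ⟨hb, κ, c₁, hκ, hc₁, heq⟩ := exists_eq_of_translation hh him hb hper
  obtain ⟨c₂, hc₂⟩ := eventually_differentiableAt_add_comp_exp hκ
  have hbC : (b : ℂ) ≠ 0 := ofReal_ne_zero.2 hb.ne'
  have hpi := Real.pi_pos
  obtain ⟨T, hT⟩ := exists_gl_entries (2 * Real.pi * I) 0 0 b
    (by simp [hbC, I_ne_zero])
  refine ⟨κ, min c₁ c₂, T, hκ, fun ζ hζ => ?_⟩
  have hζ1 : ζ.re < c₁ := hζ.trans_le (min_le_left _ _)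
  constructor
  · rw [smul_coe_eq_coe_iff, hT.1, hT.2.1, hT.2.2.1, hT.2.2.2]
    refine ⟨by simpa using hbC, ?_⟩
    rw [heq ζ hζ1]; ring
  · set η : ℂ → ℂ := fun w => w + κ (exp w) with hη
    have hηd : HasDerivAt η (deriv η ζ) ζ :=
      (hc₂ ζ (hζ.trans_le (min_le_right _ _))).hasDerivAt
    have hform : ∀ w : ℂ, w.re < c₁ → h w = b / (2 * Real.pi * I) * η w := by
      intro w hw
      have := heq w hw
      have h2 : (2 * Real.pi * I : ℂ) ≠ 0 := two_pi_I_ne_zero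
      field_simp
      linear_combination this
    have h1 : HasDerivAt h (b / (2 * Real.pi * I) * deriv η ζ) ζ := by
      refine (hηd.const_mul _).congr_of_eventuallyEq ?_
      filter_upwards [(isOpen_leftHalfPlane c₁).mem_nhds hζ1] with w hw using hform w hw
    -- The factor `b / (2π)` cancels in `‖h'‖ / Im h`, which is why `cuspProfile` has no parameter.
    have h2 : (h ζ).im = -(b / (2 * Real.pi) * (η ζ).re) := by
      have := congrArg re (heq ζ hζ1)
      rw [re_ofReal_mul] at this
      have h4 : (2 * Real.pi * I * h ζ).re = -(2 * Real.pi * (h ζ).im) := by simp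
      rw [h4] at this
      field_simp
      linarith
    have h3 : 0 < (h ζ).im := him ζ (hζ1.trans_le hc₁)
    have h5 : (η ζ).re ≠ 0 := by rintro h0; rw [h2, h0] at h3; simp at h3
    change _ = cuspProfile (η ζ).re * _
    rw [h1.deriv, halfPlaneDensity, cuspProfile, h2]
    simp only [norm_mul, norm_div, norm_real, norm_I, mul_one, Complex.norm_ofNat,
      Real.norm_of_nonneg hb.le, Real.norm_of_nonneg hpi.le]
    field_simp

/-- The case of trivial monodromy. -/
theorem hasModel_of_periodic {c : ℝ} {f : ℂ → ℂ}
    (hf : DifferentiableOn ℂ f {ζ | ζ.re < c}) (him : ∀ ζ : ℂ, ζ.re < c → 0 < (f ζ).im)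
    (hf' : ∀ ζ : ℂ, ζ.re < c → deriv f ζ ≠ 0)
    (hper : ∀ ζ : ℂ, ζ.re < c → f (ζ + 2 * Real.pi * I) = f ζ) :
    ∃ γ : ℝ, 0 < γ ∧ HasModel (fun w => exp (γ * w)) (coneProfile γ) f := by
  have hI : 0 < (I : ℂ).im := by simp
  have hfd : ∀ ζ : ℂ, ζ.re < c → HasDerivAt f (deriv f ζ) ζ := fun ζ hζ =>
    (hf.differentiableAt ((isOpen_leftHalfPlane c).mem_nhds hζ)).hasDerivAt
  -- Trivial monodromy singles out no center. A Cayley transform with arbitrary center `I` gives a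
  -- bounded periodic function, whose limit `K 0` yields the right one.
  set g : ℂ → ℂ := fun ζ => (f ζ - I) / (f ζ - conj I) with hg
  have hgd : ∀ ζ : ℂ, ζ.re < c → HasDerivAt g
      ((I - conj I) * deriv f ζ / (f ζ - conj I) ^ 2) ζ := fun ζ hζ =>
    hasDerivAt_cayley (hfd ζ hζ) (him ζ hζ) hI
  have hg1 : ∀ ζ : ℂ, ζ.re < c → ‖g ζ‖ < 1 := fun ζ hζ => norm_cayley_lt_one (him ζ hζ) hI
  obtain ⟨K, hK, hgK⟩ := exists_eq_comp_exp (k := g) (B := 1) (c := c)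
    (fun ζ hζ => (hgd ζ hζ).differentiableAt.differentiableWithinAt)
    (fun ζ hζ => by simp only [hg, hper ζ hζ]) (fun ζ hζ => (hg1 ζ hζ).le)
  have hlim : Tendsto g (comap re atBot) (𝓝 (K 0)) := by
    refine (hK.continuousAt.tendsto.comp tendsto_exp_comap_re).congr' ?_
    filter_upwards [eventually_re_lt c] with ζ hζ using (hgK ζ hζ).symm
  -- Otherwise `‖K‖` has a local maximum at `0`, so `K` is constant there by the maximum principle,
  -- against `deriv f ≠ 0`.
  have hK1 : ‖K 0‖ < 1 := by
    by_contra! hcon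
    have hmax : IsLocalMax (norm ∘ K) 0 := by
      filter_upwards [Metric.ball_mem_nhds (0 : ℂ) (Real.exp_pos c)] with z hz
      by_cases hz0 : z = 0
      · simp [hz0]
      · have h1 : (log z).re < c := by
          rw [log_re, Real.log_lt_iff_lt_exp (norm_pos_iff.2 hz0)]
          simpa using hz
        have h2 := hg1 _ h1
        rw [hgK _ h1, exp_log hz0] at h2
        exact (h2.trans_le hcon).le
    have hconst := Complex.eventually_eq_of_isLocalMax_norm
      (hK.eventually_analyticAt.mono fun z hz => hz.differentiableAt) hmax
    obtain ⟨c', hc'⟩ := exists_forall_exp_of_eventually hconst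
    set ζ₀ : ℂ := ((min c c' - 1 : ℝ) : ℂ)
    have hζ₀ : ζ₀.re < min c c' := by simp only [ζ₀, ofReal_re]; linarith
    have hζc := hζ₀.trans_le (min_le_left _ _)
    have hev : g =ᶠ[𝓝 ζ₀] fun _ => K 0 := by
      filter_upwards [(isOpen_leftHalfPlane _).mem_nhds hζ₀] with ζ hζ
      rw [hgK ζ (lt_of_lt_of_le hζ (min_le_left _ _)), hc' ζ (lt_of_lt_of_le hζ (min_le_right _ _))]
    have h0 := (hgd ζ₀ hζc).deriv
    rw [hev.deriv_eq, deriv_const] at h0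
    exact div_ne_zero (mul_ne_zero (im_pos_ne_conj hI hI) (hf' ζ₀ hζc))
        (pow_ne_zero _ (im_pos_ne_conj (him ζ₀ hζc) hI)) h0.symm
  have hK1' : 1 - K 0 ≠ 0 := by
    intro h
    rw [sub_eq_zero] at h
    simp [← h] at hK1
  -- The preimage of `K 0` under the Cayley transform, hence the limit of `f`. Around it the
  -- monodromy is a rotation with `μ = 1`.
  set τ : ℂ := I * (1 + K 0) / (1 - K 0) with hτ
  have hτim : 0 < τ.im := by
    have h1 : τ = I * ((1 + K 0) * conj (1 - K 0)) / (normSq (1 - K 0) : ℝ) := by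
      rw [hτ, normSq_eq_conj_mul_self]
      have : conj (1 - K 0) ≠ 0 := (map_ne_zero _).2 hK1'
      field_simp
    have h2 : 0 < normSq (1 - K 0) := normSq_pos.2 hK1'
    rw [h1, div_ofReal_im]
    refine div_pos ?_ h2
    have h3 : (K 0).re ^ 2 + (K 0).im ^ 2 < 1 := by
      have h4 := normSq_eq_norm_sq (K 0)
      rw [normSq_apply] at h4
      nlinarith [norm_nonneg (K 0)]
    simp
    nlinarith
  have hfg : ∀ ζ : ℂ, ζ.re < c → f ζ = I * (1 + g ζ) / (1 - g ζ) := by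
    intro ζ hζ
    have hne : f ζ + I ≠ 0 := by simpa using im_pos_ne_conj (him ζ hζ) hI
    have h1 : 1 - g ζ = 2 * I / (f ζ + I) := by
      simp only [hg, conj_I, sub_neg_eq_add]
      field_simp
      ring
    have h2 : 1 + g ζ = 2 * f ζ / (f ζ + I) := by
      simp only [hg, conj_I, sub_neg_eq_add]
      field_simp
      ring
    rw [h1, h2]
    field_simp
  refine hasModel_of_rotation (μ := 1) hf him hf' (by simp) hτim
    (fun ζ hζ => by rw [hper ζ hζ, one_mul]) fun _ => ?_
  have h1 : Tendsto (fun ζ => I * (1 + g ζ) / (1 - g ζ)) (comap re atBot) (𝓝 τ) :=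
    ((hlim.const_add 1).const_mul I).div (hlim.const_sub 1) hK1'
  refine h1.congr' ?_
  filter_upwards [eventually_re_lt c] with ζ hζ using (hfg ζ hζ).symm

/-- Invariance of the conclusion under `h = -1 / (f - x₀)`, `x₀` real. -/
lemma HasModel.of_neg_inv_sub {Φ : ℂ → ℂ} {Ψ : ℝ → ℝ} {f : ℂ → ℂ} {c x₀ : ℝ}
    (hf : DifferentiableOn ℂ f {ζ | ζ.re < c}) (him : ∀ ζ : ℂ, ζ.re < c → 0 < (f ζ).im)
    (h : HasModel Φ Ψ fun ζ => -1 / (f ζ - x₀)) : HasModel Φ Ψ f := by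
  obtain ⟨κ, c', T, hκ, hT⟩ := h
  obtain ⟨B, hB⟩ := exists_gl_entries 0 (-1) 1 (-x₀) (by norm_num)
  refine ⟨κ, min c c', T * B, hκ, fun ζ hζ => ?_⟩
  have hζc := hζ.trans_le (min_le_left _ _)
  obtain ⟨h1, h2⟩ := hT ζ (hζ.trans_le (min_le_right _ _))
  have hne : f ζ - x₀ ≠ 0 := fun h0 => (him ζ hζc).ne' (by simpa using congrArg im h0)
  constructor
  · rw [mul_smul, ← h1]
    congr 1
    rw [smul_coe_eq_coe_iff, hB.1, hB.2.1, hB.2.2.1, hB.2.2.2]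
    simp only [one_mul, zero_mul, zero_add]
    simp only [← sub_eq_add_neg]
    exact ⟨hne, (div_mul_cancel₀ _ hne).symm⟩
  · rw [← h2]
    have hd := hasDerivAt_moebius 0 (-1) 1 (-x₀)
      (hf.differentiableAt ((isOpen_leftHalfPlane c).mem_nhds hζc)).hasDerivAt
      (by simpa [← sub_eq_add_neg] using hne)
    simp only [one_mul, zero_mul, zero_add] at hd
    simp only [← sub_eq_add_neg] at hd
    rw [hd.deriv, halfPlaneDensity, halfPlaneDensity]
    have him2 : (-1 / (f ζ - x₀)).im = (f ζ).im / ‖f ζ - x₀‖ ^ 2 := by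
      rw [← normSq_eq_norm_sq, div_im]
      simp [neg_div]
    have h3 := norm_pos_iff.2 hne
    have h4 := (him ζ hζc).ne'
    rw [him2]
    simp only [norm_div, norm_pow, neg_neg, mul_one, zero_sub, one_mul]
    field_simp

/-- The case in which the translation by `2πi` acts by an affine map. -/
theorem hasModel_of_affine {c b l : ℝ} {h : ℂ → ℂ}
    (hh : DifferentiableOn ℂ h {ζ | ζ.re < c}) (him : ∀ ζ : ℂ, ζ.re < c → 0 < (h ζ).im)
    (hl : 0 < l) (hb : b ≠ 0)
    (hper : ∀ ζ : ℂ, ζ.re < c → h (ζ + 2 * Real.pi * I) = l * h ζ + b) :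
    HasModel (fun w => w) cuspProfile h := by
  by_cases hl1 : l = 1
  · exact hasModel_of_translation hh him hb fun ζ hζ => by rw [hper ζ hζ, hl1]; simp
  · exact (false_of_dilation hh him hl hl1 hper).elim

/-- Classification of the locally univalent functions into the upper half-plane on a left
half-plane for which the translation by `2πi` acts by an element of `PSL(2,ℝ)`. -/
theorem hasModel_of_monodromy {k a b c d : ℝ} {f : ℂ → ℂ}
    (hf : DifferentiableOn ℂ f {ζ | ζ.re < k}) (him : ∀ ζ : ℂ, ζ.re < k → 0 < (f ζ).im)
    (hf' : ∀ ζ : ℂ, ζ.re < k → deriv f ζ ≠ 0) (hdet : a * d - b * c = 1)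
    (hper : ∀ ζ : ℂ, ζ.re < k → (c * f ζ + d) * f (ζ + 2 * Real.pi * I) = a * f ζ + b) :
    (∃ γ : ℝ, 0 < γ ∧ HasModel (fun w => exp (γ * w)) (coneProfile γ) f) ∨
      HasModel (fun w => w) cuspProfile f := by
  have hdetC : (a * d - b * c : ℂ) = 1 := by exact_mod_cast hdet
  by_cases hc : c = 0
  · subst hc
    have had : a * d = 1 := by linarith
    have hadC : (a * d : ℂ) = 1 := by exact_mod_cast had
    have ha : a ≠ 0 := left_ne_zero_of_mul_eq_one had
    -- Since `1 / d = a`, the map `w ↦ (a w + b) / d` is `w ↦ a² w + a b`.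
    have hper' : ∀ ζ : ℂ, ζ.re < k → f (ζ + 2 * Real.pi * I) =
        (a ^ 2 : ℝ) * f ζ + (a * b : ℝ) := by
      intro ζ hζ
      have := hper ζ hζ
      push_cast at this ⊢
      linear_combination a * this - f (ζ + 2 * Real.pi * I) * hadC
    by_cases hb : b = 0
    · left
      by_cases ha1 : a ^ 2 = 1
      · refine hasModel_of_periodic hf him hf' fun ζ hζ => ?_
        rw [hper' ζ hζ, ha1, hb]; simp
      · exact (false_of_dilation hf him (by positivity) ha1 hper').elim
    · right
      exact hasModel_of_affine hf him (by positivity) (mul_ne_zero ha hb) hper'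
  · have hcC : (c : ℂ) ≠ 0 := ofReal_ne_zero.2 hc
    rcases lt_or_ge ((a + d) ^ 2) 4 with htr | htr
    · left
      -- Elliptic case. The fixed points solve `c τ² + (d - a) τ - b = 0`, of discriminant `(a + d)²
      -- - 4 < 0`; the absolute value of `c` selects the root in the upper half-plane.
      obtain ⟨y, hy, hyc⟩ : ∃ y : ℝ, 0 < y ∧ (2 * c * y) ^ 2 = 4 - (a + d) ^ 2 := by
        refine ⟨Real.sqrt (4 - (a + d) ^ 2) / (2 * |c|), ?_, ?_⟩
        · have : 0 < Real.sqrt (4 - (a + d) ^ 2) := Real.sqrt_pos.2 (by linarith)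
          positivity
        · rw [mul_pow, div_pow, Real.sq_sqrt (by linarith), mul_pow, mul_pow, sq_abs]
          field_simp
      set τ : ℂ := ((a - d) / (2 * c) : ℝ) + y * I with hτ
      have hτim : 0 < τ.im := by
        rw [hτ, add_im, ofReal_im]; simpa using hy
      have hycC : (2 * c * y : ℂ) ^ 2 = 4 - (a + d) ^ 2 := by exact_mod_cast hyc
      have hfix : c * τ ^ 2 + (d - a) * τ = b := by
        rw [hτ]; push_cast
        field_simp
        linear_combination 4 * hdetC - hycC + (4 * c ^ 2 * y ^ 2) * I_sq
      have hfix' : c * (conj τ) ^ 2 + (d - a) * conj τ = b := by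
        simpa using congrArg conj hfix
      have hne : (a : ℂ) - c * τ ≠ 0 := fun h0 => by
        have := congrArg im h0
        simp [hc, hτim.ne'] at this
      have hne' : (a : ℂ) - c * conj τ ≠ 0 := by
        have := (map_ne_zero conj).2 hne
        simpa using this
      have hcf : ∀ ζ : ℂ, ζ.re < k → (c * f ζ + d) ≠ 0 := fun ζ hζ h0 => by
        have := congrArg im h0
        simp [hc, (him ζ hζ).ne'] at this
      -- The multiplier at the fixed point is a quotient of complex conjugates, hence of norm `1`.
      -- It differs from `1` because `c * τ.im ≠ 0`, so the condition on the limit is vacuous.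
      refine hasModel_of_rotation (μ := (a - c * τ) / (a - c * conj τ)) hf him hf' ?_ hτim ?_ ?_
      · have : (a : ℂ) - c * conj τ = conj (a - c * τ) := by simp
        rw [norm_div, this, norm_conj, div_self (norm_ne_zero_iff.2 hne)]
      · intro ζ hζ
        have h1 : (c * f ζ + d) * (f (ζ + 2 * Real.pi * I) - τ) = (a - c * τ) * (f ζ - τ) := by
          linear_combination hper ζ hζ - hfix
        have h2 : (c * f ζ + d) * (f (ζ + 2 * Real.pi * I) - conj τ) =
            (a - c * conj τ) * (f ζ - conj τ) := by
          linear_combination hper ζ hζ - hfix'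
        rw [← mul_div_mul_left _ _ (hcf ζ hζ), h1, h2, mul_div_mul_comm]
      · intro h1
        rw [div_eq_one_iff_eq hne'] at h1
        have := congrArg im h1
        simp only [sub_im, ofReal_im, mul_im, ofReal_re, conj_im, zero_mul, add_zero,
          zero_sub, mul_neg, neg_neg] at this
        exact absurd (by linarith : c * τ.im = 0) (mul_ne_zero hc hτim.ne')
    · right
      -- Parabolic or hyperbolic case: the fixed point `x₀` is real, and `-1 / (f - x₀)` moves it to
      -- `∞` within the upper half-plane. The monodromy becomes affine with multiplier `(c x₀ + d)²`
      -- and a nonzero constant term; `hasModel_of_affine` excludes multipliers other than `1`.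
      obtain ⟨s, hs⟩ : ∃ s : ℝ, s ^ 2 = (a + d) ^ 2 - 4 := ⟨_, Real.sq_sqrt (by linarith)⟩
      set x₀ : ℝ := ((a - d) + s) / (2 * c) with hx₀
      have hfix : c * x₀ ^ 2 + (d - a) * x₀ = b := by
        rw [hx₀]
        field_simp
        linear_combination hs + 4 * hdet
      have hprod : (c * x₀ + d) * (a - c * x₀) = 1 := by linear_combination hdet - c * hfix
      have hfixC : (c * x₀ ^ 2 + (d - a) * x₀ : ℂ) = b := by exact_mod_cast hfix
      have hprodC : ((c * x₀ + d) * (a - c * x₀) : ℂ) = 1 := by exact_mod_cast hprod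
      have hne1 := left_ne_zero_of_mul_eq_one hprod
      have hnex : ∀ ζ : ℂ, ζ.re < k → f ζ - x₀ ≠ 0 := fun ζ hζ h0 =>
        (him ζ hζ).ne' (by simpa using congrArg im h0)
      refine HasModel.of_neg_inv_sub (x₀ := x₀) hf him
        (hasModel_of_affine (c := k) (l := (c * x₀ + d) ^ 2) (b := -(c * (c * x₀ + d)))
          ?_ ?_ (by positivity) (neg_ne_zero.2 (mul_ne_zero hc hne1)) ?_)
      · exact (differentiableOn_const _).div (hf.sub_const _) hnex
      · intro ζ hζ
        have him2 : (-1 / (f ζ - x₀)).im = (f ζ).im / normSq (f ζ - x₀) := by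
          rw [div_im]; simp [neg_div]
        rw [him2]
        exact div_pos (him ζ hζ) (normSq_pos.2 (hnex ζ hζ))
      · intro ζ hζ
        have h1 : (c * f ζ + d) * (f (ζ + 2 * Real.pi * I) - x₀) = (a - c * x₀) * (f ζ - x₀) := by
          linear_combination hper ζ hζ - hfixC
        have h2 := hnex (ζ + 2 * Real.pi * I) (by rwa [add_two_pi_mul_I_re])
        have h3 := hnex ζ hζ
        push_cast
        rw [div_eq_iff h2]
        field_simp
        linear_combination (c * x₀ + d) * h1 + (f ζ - x₀) * hprodC

/-! ### The Schwarzian derivative and the identification of the exponent -/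

lemma schwarzian_congr {f g : ℂ → ℂ} {z : ℂ} (h : f =ᶠ[𝓝 z] g) :
    schwarzian f z = schwarzian g z := by
  simp only [schwarzian, h.deriv_eq, (h.iteratedDeriv 2).eq_of_nhds,
    (h.iteratedDeriv 3).eq_of_nhds]

lemma schwarzian_comp {f g : ℂ → ℂ} {z : ℂ} (hf : AnalyticAt ℂ f (g z)) (hg : AnalyticAt ℂ g z)
    (hf' : deriv f (g z) ≠ 0) (hg' : deriv g z ≠ 0) :
    schwarzian (f ∘ g) z = schwarzian f (g z) * deriv g z ^ 2 + schwarzian g z := by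
  simp only [schwarzian]
  rw [iteratedDeriv_comp_three hf.contDiffAt hg.contDiffAt,
    iteratedDeriv_comp_two hf.contDiffAt hg.contDiffAt,
    deriv_comp z hf.differentiableAt hg.differentiableAt]
  field_simp
  ring

lemma hasDerivAt_const_div_pow {c d w : ℂ} (D : ℂ) (n : ℕ) (h : c * w + d ≠ 0) :
    HasDerivAt (fun w => D / (c * w + d) ^ n) (-(n * c * D) / (c * w + d) ^ (n + 1)) w := by
  have h1 : HasDerivAt (fun w => c * w + d) c w := by
    simpa using ((hasDerivAt_id w).const_mul c).add_const d
  have h2 := (hasDerivAt_const w D).div (h1.pow n) (pow_ne_zero n h)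
  refine h2.congr_deriv ?_
  rcases n with _ | n
  · simp
  · change (0 * (c * w + d) ^ (n + 1) - D * (((n + 1 : ℕ) : ℂ) * (c * w + d) ^ n * c)) /
      ((c * w + d) ^ (n + 1)) ^ 2 = _
    push_cast
    field_simp
    ring

/-- Here `f'' / f' = -2c / (c w + d)` and `f''' / f' = 6c² / (c w + d)²`, and `6 = (3/2) 2²`. -/
lemma schwarzian_moebius {a b c d w : ℂ} (hdet : a * d - b * c ≠ 0) (h : c * w + d ≠ 0) :
    schwarzian (fun w => (a * w + b) / (c * w + d)) w = 0 := by
  set D := a * d - b * c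
  have hne : ∀ᶠ v in 𝓝 w, c * v + d ≠ 0 :=
    (by fun_prop : ContinuousAt (fun v => c * v + d) w).eventually_ne h
  have h1 : ∀ v, c * v + d ≠ 0 →
      deriv (fun w => (a * w + b) / (c * w + d)) v = D / (c * v + d) ^ 2 := by
    intro v hv
    simpa using (hasDerivAt_moebius a b c d (hasDerivAt_id v) hv).deriv
  have h2 : ∀ v, c * v + d ≠ 0 →
      iteratedDeriv 2 (fun w => (a * w + b) / (c * w + d)) v = -(2 * c * D) / (c * v + d) ^ 3 := by
    intro v hv
    have hne : ∀ᶠ v in 𝓝 v, c * v + d ≠ 0 :=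
      (by fun_prop : ContinuousAt (fun v => c * v + d) v).eventually_ne hv
    rw [iteratedDeriv_succ, iteratedDeriv_one]
    have : deriv (fun w => (a * w + b) / (c * w + d)) =ᶠ[𝓝 v] fun v => D / (c * v + d) ^ 2 :=
      hne.mono h1
    rw [this.deriv_eq, (hasDerivAt_const_div_pow D 2 hv).deriv]
    norm_num
  have h3 : iteratedDeriv 3 (fun w => (a * w + b) / (c * w + d)) w =
      -(3 * c * -(2 * c * D)) / (c * w + d) ^ 4 := by
    rw [iteratedDeriv_succ]
    have : iteratedDeriv 2 (fun w => (a * w + b) / (c * w + d)) =ᶠ[𝓝 w]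
        fun v => -(2 * c * D) / (c * v + d) ^ 3 := hne.mono h2
    rw [this.deriv_eq, (hasDerivAt_const_div_pow _ 3 h).deriv]
    norm_num
  rw [schwarzian, h1 w h, h2 w h, h3]
  field_simp
  ring

lemma schwarzian_exp (z : ℂ) : schwarzian exp z = -1 / 2 := by
  have h : ∀ n, iteratedDeriv n exp z = exp z := by
    intro n
    rw [iteratedDeriv_eq_iterate, iter_deriv_exp]
  rw [schwarzian, h, h, Complex.deriv_exp, div_self (exp_ne_zero z)]
  norm_num

lemma schwarzian_affine (a z : ℂ) (ha : a ≠ 0) : schwarzian (fun w => a * w) z = 0 := by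
  have := schwarzian_moebius (a := a) (b := 0) (c := 0) (d := 1) (w := z) (by simpa) (by simp)
  simpa using this

lemma schwarzian_exp_mul (a z : ℂ) (ha : a ≠ 0) :
    schwarzian (fun w => exp (a * w)) z = -(a ^ 2) / 2 := by
  have h := schwarzian_comp (f := exp) (g := fun w => a * w) (z := z)
    analyticAt_cexp (by fun_prop) (by simp [exp_ne_zero]) (by simp [ha])
  rw [schwarzian_affine a z ha, schwarzian_exp] at h
  have h1 : deriv (fun w => a * w) z = a := by simp
  rw [h1] at h
  exact h.trans (by ring)

/-- `L • w` in terms of the entries of `L`. -/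
def moebius (L : GL (Fin 2) ℂ) (w : ℂ) : ℂ := (L 0 0 * w + L 0 1) / (L 1 0 * w + L 1 1)

lemma gl_det_ne_zero (L : GL (Fin 2) ℂ) : L 0 0 * L 1 1 - L 0 1 * L 1 0 ≠ 0 := by
  have := L.det_ne_zero
  rwa [Matrix.det_fin_two] at this

lemma smul_coe_eq_coe_iff_moebius {L : GL (Fin 2) ℂ} {w w' : ℂ} :
    L • (w : OnePoint ℂ) = (w' : OnePoint ℂ) ↔ L 1 0 * w + L 1 1 ≠ 0 ∧ w' = moebius L w := by
  rw [smul_coe_eq_coe_iff, moebius]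
  refine and_congr_right fun h => ?_
  rw [eq_div_iff h, eq_comm]

lemma hasDerivAt_moebius_comp (L : GL (Fin 2) ℂ) {f : ℂ → ℂ} {f' z : ℂ} (hf : HasDerivAt f f' z)
    (h : L 1 0 * f z + L 1 1 ≠ 0) :
    HasDerivAt (moebius L ∘ f)
      ((L 0 0 * L 1 1 - L 0 1 * L 1 0) * f' / (L 1 0 * f z + L 1 1) ^ 2) z :=
  hasDerivAt_moebius _ _ _ _ hf h

lemma analyticAt_moebius (L : GL (Fin 2) ℂ) {w : ℂ} (h : L 1 0 * w + L 1 1 ≠ 0) :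
    AnalyticAt ℂ (moebius L) w :=
  AnalyticAt.div (by fun_prop) (by fun_prop) h

lemma deriv_moebius_ne_zero (L : GL (Fin 2) ℂ) {w : ℂ} (h : L 1 0 * w + L 1 1 ≠ 0) :
    deriv (moebius L) w ≠ 0 := by
  have := (hasDerivAt_moebius_comp L (hasDerivAt_id w) h).deriv
  rw [Function.comp_id] at this
  rw [this]
  exact div_ne_zero (mul_ne_zero (gl_det_ne_zero L) one_ne_zero) (pow_ne_zero _ h)

/-- The Schwarzian derivative is invariant under fractional linear transformations. -/
lemma schwarzian_moebius_comp (L : GL (Fin 2) ℂ) {f : ℂ → ℂ} {z : ℂ} (hf : AnalyticAt ℂ f z)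
    (hf' : deriv f z ≠ 0) (h : L 1 0 * f z + L 1 1 ≠ 0) :
    schwarzian (moebius L ∘ f) z = schwarzian f z := by
  rw [schwarzian_comp (analyticAt_moebius L h) hf (deriv_moebius_ne_zero L h) hf']
  have : schwarzian (moebius L) (f z) = 0 := schwarzian_moebius (gl_det_ne_zero L) h
  rw [this]; ring

lemma AnalyticAt.continuousAt_schwarzian {f : ℂ → ℂ} {z : ℂ} (hf : AnalyticAt ℂ f z)
    (hf' : deriv f z ≠ 0) : ContinuousAt (schwarzian f) z := by
  have h2 : ContinuousAt (iteratedDeriv 2 f) z := by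
    rw [iteratedDeriv_eq_iterate]; exact (hf.iterated_deriv 2).continuousAt
  have h3 : ContinuousAt (iteratedDeriv 3 f) z := by
    rw [iteratedDeriv_eq_iterate]; exact (hf.iterated_deriv 3).continuousAt
  have h1 := hf.deriv.continuousAt
  exact (h3.div h1 hf').sub (continuousAt_const.mul ((h2.div h1 hf').pow 2))

lemma hasDerivAt_add_comp_exp {κ : ℂ → ℂ} {ζ : ℂ} (hκ : DifferentiableAt ℂ κ (exp ζ)) :
    HasDerivAt (fun w => w + κ (exp w)) (1 + deriv κ (exp ζ) * exp ζ) ζ :=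
  (hasDerivAt_id ζ).add (hκ.hasDerivAt.comp ζ (hasDerivAt_exp ζ))

/-- `z ↦ z exp (κ z)` has derivative `exp (κ 0)` at `0`. -/
lemma hasDerivAt_mul_exp {κ : ℂ → ℂ} {z : ℂ} (hκ : DifferentiableAt ℂ κ z) :
    HasDerivAt (fun z => z * exp (κ z)) (exp (κ z) * (1 + z * deriv κ z)) z :=
  ((hasDerivAt_id z).mul hκ.hasDerivAt.cexp).congr_deriv (by simp; ring)

lemma tendsto_deriv_add_comp_exp {κ : ℂ → ℂ} (hκ : AnalyticAt ℂ κ 0) :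
    Tendsto (deriv fun w => w + κ (exp w)) (comap re atBot) (𝓝 1) := by
  have h1 : Tendsto (fun z => 1 + deriv κ z * z) (𝓝 0) (𝓝 1) := by
    have : ContinuousAt (fun z => 1 + deriv κ z * z) 0 :=
      continuousAt_const.add (hκ.deriv.continuousAt.mul continuousAt_id)
    simpa [ContinuousAt] using this
  refine (h1.comp tendsto_exp_comap_re).congr' ?_
  obtain ⟨c, hc⟩ := exists_forall_exp_of_eventually hκ.eventually_analyticAt
  filter_upwards [eventually_re_lt c] with ζ hζ
  exact (hasDerivAt_add_comp_exp (hc ζ hζ).differentiableAt).deriv.symm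

/-- With `W z = z exp (κ z)` one has `exp ∘ η = W ∘ exp`. The chain rule on both sides expresses the
Schwarzian derivative of `η` by that of `W`, which is continuous at `0` because `W' 0 ≠ 0`, and by
`η'`, which tends to `1`. No third derivative of `η` has to be expanded. -/
lemma tendsto_schwarzian_add_comp_exp {κ : ℂ → ℂ} (hκ : AnalyticAt ℂ κ 0) :
    Tendsto (schwarzian fun w => w + κ (exp w)) (comap re atBot) (𝓝 0) := by
  set η : ℂ → ℂ := fun w => w + κ (exp w) with hη
  set W : ℂ → ℂ := fun z => z * exp (κ z) with hW
  have hWa : ∀ z, AnalyticAt ℂ κ z → AnalyticAt ℂ W z := fun z hz => analyticAt_id.mul hz.cexp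
  have hW0 : deriv W 0 ≠ 0 := by
    rw [(hasDerivAt_mul_exp hκ.differentiableAt).deriv]; simp [exp_ne_zero]
  have hlim : Tendsto (fun ζ => schwarzian W (exp ζ) * exp ζ ^ 2 - 1 / 2 + 1 / 2 * deriv η ζ ^ 2)
      (comap re atBot) (𝓝 (schwarzian W 0 * 0 ^ 2 - 1 / 2 + 1 / 2 * 1 ^ 2)) :=
    (((((AnalyticAt.continuousAt_schwarzian (hWa 0 hκ) hW0).tendsto.comp tendsto_exp_comap_re).mul
      (tendsto_exp_comap_re.pow 2)).sub_const _)).add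
      (((tendsto_deriv_add_comp_exp hκ).pow 2).const_mul _)
  norm_num at hlim
  refine hlim.congr' ?_
  obtain ⟨c, hc⟩ := exists_forall_exp_of_eventually (hκ.eventually_analyticAt.and
    ((hWa 0 hκ).deriv.continuousAt.eventually_ne hW0))
  filter_upwards [eventually_re_lt c, (tendsto_deriv_add_comp_exp hκ).eventually_ne one_ne_zero]
    with ζ hζ hηζ
  obtain ⟨hκζ, hWζ⟩ := hc ζ hζ
  have hηa : AnalyticAt ℂ η ζ := analyticAt_id.add (hκζ.comp analyticAt_cexp)
  have e1 := schwarzian_comp (f := exp) (g := η) (z := ζ) analyticAt_cexp hηa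
    (by simp [exp_ne_zero]) hηζ
  have e2 := schwarzian_comp (f := W) (g := exp) (z := ζ) (hWa _ hκζ) analyticAt_cexp hWζ
    (by simp [exp_ne_zero])
  have e3 : exp ∘ η = W ∘ exp := by
    funext w
    simp only [Function.comp_apply, hη, hW, exp_add]
  rw [e3, e2, schwarzian_exp, schwarzian_exp, Complex.deriv_exp] at e1
  linear_combination e1

/-- The limit of the Schwarzian derivative of a function with a local model. -/
lemma HasModel.tendsto_schwarzian {Φ : ℂ → ℂ} {Ψ : ℝ → ℝ} {f : ℂ → ℂ} {s : ℂ}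
    (hΦ : ∀ w, AnalyticAt ℂ Φ w) (hΦ' : ∀ w, deriv Φ w ≠ 0) (hs : ∀ w, schwarzian Φ w = s)
    (h : HasModel Φ Ψ f) : Tendsto (schwarzian f) (comap re atBot) (𝓝 s) := by
  obtain ⟨κ, c, T, hκ, hT⟩ := h
  set η : ℂ → ℂ := fun w => w + κ (exp w) with hη
  have hlim : Tendsto (fun ζ => s * deriv η ζ ^ 2 + schwarzian η ζ) (comap re atBot)
      (𝓝 (s * 1 ^ 2 + 0)) :=
    (((tendsto_deriv_add_comp_exp hκ).pow 2).const_mul s).add (tendsto_schwarzian_add_comp_exp hκ)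
  rw [one_pow, mul_one, add_zero] at hlim
  refine hlim.congr' ?_
  obtain ⟨c', hc'⟩ := exists_forall_exp_of_eventually hκ.eventually_analyticAt
  filter_upwards [eventually_re_lt c, eventually_re_lt c',
    (tendsto_deriv_add_comp_exp hκ).eventually_ne one_ne_zero] with ζ hζ hζ' hηζ
  have hηa : AnalyticAt ℂ η ζ := analyticAt_id.add ((hc' ζ hζ').comp analyticAt_cexp)
  have hinv : ∀ w : ℂ, w.re < c → T⁻¹ 1 0 * Φ (η w) + T⁻¹ 1 1 ≠ 0 ∧ f w = moebius T⁻¹ (Φ (η w)) := by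
    intro w hw
    rw [← smul_coe_eq_coe_iff_moebius, inv_smul_eq_iff]
    exact (hT w hw).1.symm
  have hf : f =ᶠ[𝓝 ζ] moebius T⁻¹ ∘ (Φ ∘ η) := by
    filter_upwards [(isOpen_leftHalfPlane c).mem_nhds hζ] with w hw using (hinv w hw).2
  have hΦη : AnalyticAt ℂ (Φ ∘ η) ζ := (hΦ _).comp hηa
  rw [schwarzian_congr hf, schwarzian_moebius_comp T⁻¹ hΦη ?_ (hinv ζ hζ).1,
    schwarzian_comp (hΦ _) hηa (hΦ' _) hηζ, hs]
  rw [deriv_comp ζ (hΦ _).differentiableAt hηa.differentiableAt]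
  exact mul_ne_zero (hΦ' _) hηζ

/-- The limit of the Schwarzian derivative in the logarithm of the coordinate. -/
lemma tendsto_schwarzian_of_form {f φ : ℂ → ℂ} {θ c : ℝ} {d : ℂ} (hφ : ContinuousAt φ 0)
    (h : ∀ ζ : ℂ, ζ.re < c → ∃ G : ℂ → ℂ, AnalyticAt ℂ G (exp ζ) ∧ deriv G (exp ζ) ≠ 0 ∧
      f =ᶠ[𝓝 ζ] G ∘ exp ∧ schwarzian G (exp ζ) =
        (1 - (θ : ℂ) ^ 2) / (2 * exp ζ ^ 2) + d / exp ζ + φ (exp ζ)) :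
    Tendsto (schwarzian f) (comap re atBot) (𝓝 (-(θ ^ 2) / 2)) := by
  -- The given form times `(exp' ζ)² = z²`, plus the Schwarzian derivative `-1 / 2` of `exp`.
  have h1 : Tendsto (fun z : ℂ => (-(θ ^ 2) / 2 : ℂ) + d * z + φ z * z ^ 2) (𝓝 0)
      (𝓝 (-(θ ^ 2) / 2)) := by
    have : ContinuousAt (fun z : ℂ => (-(θ ^ 2) / 2 : ℂ) + d * z + φ z * z ^ 2) 0 := by fun_prop
    simpa [ContinuousAt] using this
  refine (h1.comp tendsto_exp_comap_re).congr' ?_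
  filter_upwards [eventually_re_lt c] with ζ hζ
  obtain ⟨G, hG, hG', hfG, hS⟩ := h ζ hζ
  rw [schwarzian_congr hfG, schwarzian_comp hG analyticAt_cexp hG' (by simp [exp_ne_zero]), hS,
    schwarzian_exp, Complex.deriv_exp, Function.comp_apply]
  have := exp_ne_zero ζ
  field_simp
  ring

/-- The local model is determined by the exponent in the Schwarzian derivative. -/
theorem HasModel.of_tendsto_schwarzian {f : ℂ → ℂ} {θ : ℝ} (hθ : 0 ≤ θ)
    (h : (∃ γ : ℝ, 0 < γ ∧ HasModel (fun w => exp (γ * w)) (coneProfile γ) f) ∨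
      HasModel (fun w => w) cuspProfile f)
    (hS : Tendsto (schwarzian f) (comap re atBot) (𝓝 (-(θ ^ 2) / 2))) :
    (0 < θ → HasModel (fun w => exp (θ * w)) (coneProfile θ) f) ∧
      (θ = 0 → HasModel (fun w => w) cuspProfile f) := by
  rcases h with ⟨γ, hγ, h⟩ | h
  · have hγC : (γ : ℂ) ≠ 0 := ofReal_ne_zero.2 hγ.ne'
    have hlim := h.tendsto_schwarzian (fun w => by fun_prop)
      (fun w => by
        have h2 : HasDerivAt (fun w : ℂ => exp (γ * w)) (exp (γ * w) * (γ * 1)) w :=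
          ((hasDerivAt_id w).const_mul (γ : ℂ)).cexp
        rw [h2.deriv, mul_one]
        exact mul_ne_zero (exp_ne_zero _) hγC)
      (fun w => schwarzian_exp_mul γ w hγC)
    have h1 := tendsto_nhds_unique hlim hS
    have h2 : γ ^ 2 = θ ^ 2 := by
      have : (γ : ℂ) ^ 2 = θ ^ 2 := by linear_combination -2 * h1
      exact_mod_cast this
    have h3 : γ = θ := (pow_left_inj₀ hγ.le hθ two_ne_zero).1 h2
    subst h3
    exact ⟨fun _ => h, fun h0 => absurd h0 hγ.ne'⟩
  · have hlim := h.tendsto_schwarzian (s := 0) (fun w => by fun_prop) (fun w => by simp)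
      (fun w => by simpa using schwarzian_affine 1 w one_ne_zero)
    have h1 := tendsto_nhds_unique hlim hS
    have h2 : θ = 0 := by
      have : (θ : ℂ) ^ 2 = 0 := by linear_combination 2 * h1
      exact_mod_cast pow_eq_zero_iff two_ne_zero |>.1 this
    exact ⟨fun h0 => absurd h2 h0.ne', fun _ => h⟩

/-! ### Curvature of the pullback metric -/

lemma hasFDerivAt_im_comp {g : ℂ → ℂ} {g' z : ℂ} (hg : HasDerivAt g g' z) :
    HasFDerivAt (fun w => (g w).im)
      (imCLM.comp ((ContinuousLinearMap.toSpanSingleton ℂ g').restrictScalars ℝ)) z :=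
  imCLM.hasFDerivAt.comp z (hg.hasFDerivAt.restrictScalars ℝ)

lemma analyticAt_contDiffAt_real {g : ℂ → ℂ} {z : ℂ} (hg : AnalyticAt ℂ g z) (n : ℕ∞) :
    ContDiffAt ℝ n g z :=
  (hg.contDiffAt (n := n)).restrict_scalars ℝ

lemma contDiffAt_im {g : ℂ → ℂ} {z : ℂ} (hg : AnalyticAt ℂ g z) (n : ℕ∞) :
    ContDiffAt ℝ n (fun w => (g w).im) z :=
  imCLM.contDiff.contDiffAt.comp z (analyticAt_contDiffAt_real hg n)

/-- For the Laplacian this is summed over `v = 1` and `v = I`: the terms with `g''` cancel because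
`1 + I² = 0`, and `-|g'|² / (Im g)²` remains. -/
lemma iteratedFDeriv_two_log_im {g : ℂ → ℂ} {z : ℂ} (hg : AnalyticAt ℂ g z) (him : 0 < (g z).im)
    (v : ℂ) :
    iteratedFDeriv ℝ 2 (fun w => Real.log (g w).im) z ![v, v] =
      (v * v * deriv (deriv g) z).im / (g z).im - (v * deriv g z).im ^ 2 / (g z).im ^ 2 := by
  have hd : ∀ w, AnalyticAt ℂ g w → 0 < (g w).im →
      HasFDerivAt (fun w => Real.log (g w).im) ((g w).im⁻¹ •
        imCLM.comp ((ContinuousLinearMap.toSpanSingleton ℂ (deriv g w)).restrictScalars ℝ)) w :=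
    fun w hw hw' => (hasFDerivAt_im_comp hw.differentiableAt.hasDerivAt).log hw'.ne'
  have hcd : ContDiffAt ℝ 2 (fun w => Real.log (g w).im) z := (contDiffAt_im hg 2).log him.ne'
  have hdd : DifferentiableAt ℝ (fderiv ℝ fun w => Real.log (g w).im) z :=
    (hcd.fderiv_right (m := 1) (by norm_num)).differentiableAt (by norm_num)
  rw [iteratedFDeriv_two_apply]
  simp only [Matrix.cons_val_zero, Matrix.cons_val_one]
  have h1 : fderiv ℝ (fderiv ℝ fun w => Real.log (g w).im) z v v =
      fderiv ℝ (fun w => fderiv ℝ (fun w => Real.log (g w).im) w v) z v := by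
    rw [fderiv_clm_apply hdd (differentiableAt_const v)]
    simp
  have h2 : (fun w => fderiv ℝ (fun w => Real.log (g w).im) w v) =ᶠ[𝓝 z]
      fun w => (g w).im⁻¹ * (v * deriv g w).im := by
    filter_upwards [hg.eventually_analyticAt, (continuous_im.continuousAt.comp
      hg.continuousAt).eventually (lt_mem_nhds him)] with w hw hw'
    rw [(hd w hw hw').fderiv]
    simp
  have h3 := (((hasDerivAt_inv him.ne').comp_hasFDerivAt z
    (hasFDerivAt_im_comp hg.differentiableAt.hasDerivAt))).mul
    (hasFDerivAt_im_comp (hg.deriv.differentiableAt.hasDerivAt.const_mul v))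
  rw [h1, h2.fderiv_eq]
  erw [h3.fderiv]
  simp
  field_simp
  ring

/-- The pullback of the hyperbolic metric of the upper half-plane has curvature `-1`. -/
theorem laplacian_log_pullback {g : ℂ → ℂ} {z : ℂ} (hg : AnalyticAt ℂ g z)
    (him : 0 < (g z).im) (hg' : deriv g z ≠ 0) :
    Laplacian.laplacian
      (fun w => 1 / 2 * Real.log (halfPlaneDensity (g w) * ‖deriv g w‖ ^ 2)) z =
      halfPlaneDensity (g z) * ‖deriv g z‖ ^ 2 := by
  have hcd : ContDiffAt ℝ 2 (fun w => Real.log (g w).im) z := (contDiffAt_im hg 2).log him.ne'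
  have hharm := hg.deriv.harmonicAt_log_norm hg'
  -- Half the logarithm of the density is `-log (Im g) + log |g'|`, and the second term is harmonic.
  have heq : (fun w => 1 / 2 * Real.log (halfPlaneDensity (g w) * ‖deriv g w‖ ^ 2)) =ᶠ[𝓝 z]
      (-1 : ℝ) • (fun w => Real.log (g w).im) + fun w => Real.log ‖deriv g w‖ := by
    filter_upwards [(continuous_im.continuousAt.comp hg.continuousAt).eventually (lt_mem_nhds him),
      hg.deriv.continuousAt.eventually_ne hg'] with w hw hw'
    have hw1 : 0 < (g w).im := hw
    have hn := norm_pos_iff.2 hw'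
    simp only [Pi.add_apply, Pi.smul_apply, smul_eq_mul, halfPlaneDensity]
    rw [Real.log_mul (by positivity) (by positivity), Real.log_div one_ne_zero (by positivity),
      Real.log_pow, Real.log_pow, Real.log_one]
    push_cast
    ring
  have hcd' : ContDiffAt ℝ 2 ((-1 : ℝ) • fun w => Real.log (g w).im) z := hcd.const_smul (-1 : ℝ)
  rw [(InnerProductSpace.laplacian_congr_nhds heq).eq_of_nhds,
    ContDiffAt.laplacian_add hcd' hharm.1,
    InnerProductSpace.laplacian_smul _ hcd, hharm.2.eq_of_nhds,
    InnerProductSpace.laplacian_eq_iteratedFDeriv_complexPlane]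
  simp only [iteratedFDeriv_two_log_im hg him, halfPlaneDensity]
  have h1 : ‖deriv g z‖ ^ 2 = (deriv g z).re ^ 2 + (deriv g z).im ^ 2 := by
    rw [← normSq_eq_norm_sq, normSq_apply]; ring
  rw [h1]
  simp
  field_simp
  ring

/-! ### Changes of coordinate -/

section Coordinates

variable {M : Type u} [TopologicalSpace M] [ChartedSpace ℂ M]

lemma mem_contDiffGroupoid_omega_iff {H : OpenPartialHomeomorph ℂ ℂ} :
    H ∈ contDiffGroupoid ω 𝓘(ℂ) ↔ ContDiffOn ℂ ω H H.source ∧ ContDiffOn ℂ ω H.symm H.target := by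
  rw [contDiffGroupoid, mem_groupoid_of_pregroupoid]
  simp [contDiffPregroupoid]

lemma IsCoord.analyticAt_comp_symm [IsManifold 𝓘(ℂ) ω M] {e e' : OpenPartialHomeomorph M ℂ}
    (he : IsCoord e) (he' : IsCoord e') {q : M} (hq : q ∈ e.source) (hq' : q ∈ e'.source) :
    AnalyticAt ℂ (e' ∘ e.symm) (e q) := by
  have h := (mem_contDiffGroupoid_omega_iff.1
    (StructureGroupoid.compatible_of_mem_maximalAtlas he he')).1
  have hmem : e q ∈ (e.symm ≫ₕ e').source := by
    simp [hq, hq']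
  exact (h.contDiffAt ((e.symm ≫ₕ e').open_source.mem_nhds hmem)).analyticAt

lemma IsCoord.trans {e : OpenPartialHomeomorph M ℂ} (he : IsCoord e)
    {H : OpenPartialHomeomorph ℂ ℂ} (hH : H ∈ contDiffGroupoid ω 𝓘(ℂ)) : IsCoord (e ≫ₕ H) := by
  refine mem_maximalAtlas_iff.2 fun e' he' => ?_
  obtain ⟨h1, h2⟩ := mem_maximalAtlas_iff.1 he e' he'
  constructor
  · rw [OpenPartialHomeomorph.trans_symm_eq_symm_trans_symm, OpenPartialHomeomorph.trans_assoc]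
    exact StructureGroupoid.trans _ (StructureGroupoid.symm _ hH) h1
  · rw [← OpenPartialHomeomorph.trans_assoc]
    exact StructureGroupoid.trans _ h2 hH

/-- Change of a centered coordinate `z` to `z exp (κ z)`. -/
theorem IsCenteredCoord.exists_mul_exp {S : Set M} {p : M} {e : OpenPartialHomeomorph M ℂ}
    (he : IsCenteredCoord S p e) {κ : ℂ → ℂ} (hκ : AnalyticAt ℂ κ 0) {R : ℝ} (hR : 0 < R) :
    ∃ e' : OpenPartialHomeomorph M ℂ, IsCenteredCoord S p e' ∧ IsConnected e'.source ∧
      e'.source ⊆ e.source ∧ ∀ q ∈ e'.source, ‖e q‖ < R ∧ ‖e' q‖ < 1 ∧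
        e' q = e q * exp (κ (e q)) ∧ AnalyticAt ℂ κ (e q) := by
  obtain ⟨hec, hp, hp0, hS⟩ := he
  set W : ℂ → ℂ := fun z => z * exp (κ z) with hW
  have hWa : ∀ z, AnalyticAt ℂ κ z → AnalyticAt ℂ W z := fun z hz => analyticAt_id.mul hz.cexp
  have hW0 : deriv W 0 ≠ 0 := by
    rw [(hasDerivAt_mul_exp hκ.differentiableAt).deriv]; simp [exp_ne_zero]
  have hs : HasStrictDerivAt W (deriv W 0) 0 := (hWa 0 hκ).hasStrictDerivAt
  set H := (hs.hasStrictFDerivAt_equiv hW0).toOpenPartialHomeomorph W with hH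
  have hHW : ∀ z, H z = W z := fun z => rfl
  have h0H : (0 : ℂ) ∈ H.source :=
    (hs.hasStrictFDerivAt_equiv hW0).mem_toOpenPartialHomeomorph_source
  obtain ⟨r, hr, hball⟩ := Metric.eventually_nhds_iff_ball.1
    (hκ.eventually_analyticAt.and ((hWa 0 hκ).deriv.continuousAt.eventually_ne hW0))
  -- On the smaller ball `κ` is analytic and `W' ≠ 0`, so that the inverse of `W` is analytic as
  -- well.
  set H₁ := H.restr (Metric.ball 0 (min r R)) with hH₁
  have hsrc : H₁.source = H.source ∩ Metric.ball 0 (min r R) := by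
    rw [hH₁, OpenPartialHomeomorph.restr_source, Metric.isOpen_ball.interior_eq]
  have hsub : ∀ z ∈ H₁.source, AnalyticAt ℂ κ z ∧ deriv W z ≠ 0 ∧ ‖z‖ < R := by
    intro z hz
    rw [hsrc] at hz
    have h1 := hball z (Metric.ball_subset_ball (min_le_left _ _) hz.2)
    exact ⟨h1.1, h1.2, by simpa using Metric.ball_subset_ball (min_le_right _ _) hz.2⟩
  have hgr : H₁ ∈ contDiffGroupoid ω 𝓘(ℂ) := by
    refine mem_contDiffGroupoid_omega_iff.2 ⟨fun z hz => ?_, fun z hz => ?_⟩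
    · exact (hWa z (hsub z hz).1).contDiffAt.contDiffWithinAt
    · have h1 := hsub _ (H₁.map_target hz)
      exact (H₁.contDiffAt_symm_deriv h1.2.1 hz (hWa _ h1.1).differentiableAt.hasDerivAt
        (hWa _ h1.1).contDiffAt).contDiffWithinAt
  set e₁ := e ≫ₕ H₁ with he₁
  have he₁q : ∀ q, e₁ q = e q * exp (κ (e q)) := fun q => rfl
  have hpe₁ : p ∈ e₁.source := by
    rw [he₁, OpenPartialHomeomorph.trans_source, hsrc]
    exact ⟨hp, by simpa [hp0] using h0H, by simp [hp0, hr, hR]⟩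
  have he₁p : e₁ p = 0 := by rw [he₁q, hp0, zero_mul]
  obtain ⟨ρ, hρ, hρt⟩ := Metric.isOpen_iff.1 e₁.open_target 0 (he₁p ▸ e₁.map_source hpe₁)
  -- The second restriction is made in the target: the source becomes the homeomorphic image of a
  -- ball, hence connected, and the coordinate has norm less than `1`.
  set B := Metric.ball (0 : ℂ) (min ρ 1) with hB
  have hBt : B ⊆ e₁.target := (Metric.ball_subset_ball (min_le_left _ _)).trans hρt
  have hopen : IsOpen (e₁.symm '' B) := e₁.symm.isOpen_image_of_subset_source Metric.isOpen_ball hBt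
  set e' := e₁.restr (e₁.symm '' B) with he'
  have hsrc' : e'.source = e₁.symm '' B := by
    rw [he', OpenPartialHomeomorph.restr_source, hopen.interior_eq, inter_eq_right]
    rintro _ ⟨z, hz, rfl⟩
    exact e₁.map_target (hBt hz)
  have hmem : ∀ q ∈ e'.source, q ∈ e₁.source ∧ e₁ q ∈ B := by
    intro q hq
    rw [hsrc'] at hq
    obtain ⟨z, hz, rfl⟩ := hq
    exact ⟨e₁.map_target (hBt hz), by rwa [e₁.right_inv (hBt hz)]⟩
  have hsube : e'.source ⊆ e.source := fun q hq => (hmem q hq).1.1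
  refine ⟨e', ⟨?_, ?_, he₁p, ?_⟩, ?_, hsube, ?_⟩
  · exact restr_mem_maximalAtlas _ (hec.trans hgr) hopen
  · rw [hsrc']
    exact ⟨0, Metric.mem_ball_self (lt_min hρ one_pos), by rw [← he₁p, e₁.left_inv hpe₁]⟩
  · exact fun q hq => hS ⟨hsube hq.1, hq.2⟩
  · rw [hsrc']
    exact ((convex_ball _ _).isConnected (Metric.nonempty_ball.2 (lt_min hρ one_pos))).image _
      (e₁.continuousOn_symm.mono hBt)
  · intro q hq
    obtain ⟨h1, h2⟩ := hmem q hq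
    have h3 := hsub (e q) h1.2
    refine ⟨h3.2.2, ?_, rfl, h3.1⟩
    exact mem_ball_zero_iff.1 (Metric.ball_subset_ball (min_le_right _ _) h2)

end Coordinates

/-! ### Function elements and monodromy -/

section Elements

variable {M : Type u} [TopologicalSpace M] {S : Set M} {F : MultivaluedFunction.{u, v} M S}

lemma MultivaluedFunction.continuous_coe_proj (F : MultivaluedFunction.{u, v} M S) :
    Continuous fun y => (F.proj y : M) :=
  continuous_subtype_val.comp F.isCovering.continuous

lemma MultivaluedFunction.isOpenMap_coe_proj (F : MultivaluedFunction.{u, v} M S)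
    (hS : IsClosed S) : IsOpenMap fun y => (F.proj y : M) :=
  hS.isOpen_compl.isOpenMap_subtype_val.comp F.isCovering.isOpenMap

/-- Coverings are open maps and `S` is closed, so local statements upstairs descend to `M`. -/
lemma MultivaluedFunction.eventually_coe_proj (F : MultivaluedFunction.{u, v} M S)
    (hS : IsClosed S) {x : F.cover} {P : M → Prop} (h : ∀ᶠ y in 𝓝 x, P (F.proj y)) :
    ∀ᶠ q in 𝓝 (F.proj x : M), P q :=
  (F.isOpenMap_coe_proj hS).nhds_le x h

lemma IsElement.self {x : F.cover} {g : M → ℂ} (h : IsElement F x g) :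
    F.toFun x = g (F.proj x) := h.self_of_nhds

lemma IsElement.eventuallyEq (hS : IsClosed S) {x : F.cover} {g g' : M → ℂ}
    (h : IsElement F x g) (h' : IsElement F x g') : g =ᶠ[𝓝 (F.proj x : M)] g' :=
  F.eventually_coe_proj hS (by
    filter_upwards [h, h'] with y hy hy'
    rw [← hy, hy'])

/-- Points near the projection of `x` are projections of points with the same function element. -/
lemma IsElement.eventually_exists (hS : IsClosed S) {x : F.cover} {g : M → ℂ}
    (h : IsElement F x g) :
    ∀ᶠ q in 𝓝 (F.proj x : M), ∃ y : F.cover, (F.proj y : M) = q ∧ IsElement F y g :=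
  F.eventually_coe_proj hS (by
    filter_upwards [(eventually_eventually_nhds (p := fun y => F.toFun y = g (F.proj y))).2 h]
      with y hy using ⟨y, rfl, hy⟩)

/-- The covering is path connected. A path from `x` to `y` projects to a loop whose lift at `x` is
the path itself, so the monodromy of this loop carries `x` to `y`. -/
lemma MonodromyIn.exists_related {Γ : Set (GL (Fin 2) ℂ)} (h : MonodromyIn F Γ)
    {x y : F.cover} (hxy : F.proj x = F.proj y) : ∃ L ∈ Γ, ElementsRelated F y x L := by
  obtain ⟨γ⟩ := PathConnectedSpace.joined x y
  set Q : Path.Homotopic.Quotient x y := Path.Homotopic.Quotient.mk γ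
  obtain ⟨L, hL, hrel⟩ := h (F.proj x)
    ((Q.map ⟨F.proj, F.isCovering.continuous⟩).cast rfl hxy) ⟨x, rfl⟩
  have hmon := F.isCovering.monodromy_eq_of_map_eq
    (γ := (Q.map ⟨F.proj, F.isCovering.continuous⟩).cast rfl hxy)
    (ex := ⟨x, rfl⟩) (ey := ⟨y, hxy.symm⟩) Q rfl
  rw [hmon] at hrel
  exact ⟨L, hL, hrel⟩

end Elements

/-! ### Lifting the logarithm of a coordinate to the covering -/

section LogLift

variable {M : Type u} [TopologicalSpace M] {S : Set M} {F : MultivaluedFunction.{u, v} M S}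
  {e : OpenPartialHomeomorph M ℂ} {c : ℝ} {p : M}

/-- `φ` lifts `ζ ↦ e⁻¹ (exp ζ)`, `Re ζ < c`, to the covering of `F`. -/
def IsLogLift (F : MultivaluedFunction.{u, v} M S) (e : OpenPartialHomeomorph M ℂ) (c : ℝ)
    (φ : ℂ → F.cover) : Prop :=
  ContinuousOn φ {ζ | ζ.re < c} ∧ ∀ ζ : ℂ, ζ.re < c → (F.proj (φ ζ) : M) = e.symm (exp ζ)

lemma exp_mem_of_re_lt {s : Set ℂ} (hs : Metric.ball 0 (Real.exp c) ⊆ s) {ζ : ℂ} (hζ : ζ.re < c) :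
    exp ζ ∈ s :=
  hs (by simpa [norm_exp] using hζ)

lemma symm_exp_notMem (he : e.source ∩ S ⊆ {p}) (hp0 : e p = 0)
    (hs : Metric.ball 0 (Real.exp c) ⊆ e.target) {ζ : ℂ} (hζ : ζ.re < c) :
    e.symm (exp ζ) ∉ S := by
  intro h
  have h1 : e.symm (exp ζ) = p := he ⟨e.map_target (exp_mem_of_re_lt hs hζ), h⟩
  have h2 := e.right_inv (exp_mem_of_re_lt hs hζ)
  rw [h1, hp0] at h2
  exact exp_ne_zero ζ h2.symm

/-- A half-plane is contractible and locally path connected, so every map from it to `Sᶜ` lifts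
through the covering, with prescribed value at one point. -/
theorem exists_isLogLift (he : e.source ∩ S ⊆ {p}) (hp0 : e p = 0)
    (hs : Metric.ball 0 (Real.exp c) ⊆ e.target) (x₀ : F.cover) {ζ₀ : ℂ} (hζ₀ : ζ₀.re < c)
    (hx₀ : (F.proj x₀ : M) = e.symm (exp ζ₀)) :
    ∃ φ : ℂ → F.cover, IsLogLift F e c φ ∧ φ ζ₀ = x₀ := by
  classical
  have hne : {ζ : ℂ | ζ.re < c}.Nonempty := ⟨ζ₀, hζ₀⟩
  have : ContractibleSpace {ζ : ℂ | ζ.re < c} := (convex_leftHalfPlane c).contractibleSpace hne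
  have : LocallyPathConnectedSpace {ζ : ℂ | ζ.re < c} :=
    (isOpen_leftHalfPlane c).locallyPathConnectedSpace
  let f : C({ζ : ℂ | ζ.re < c}, ↥Sᶜ) :=
    ⟨fun ζ => ⟨e.symm (exp ζ), symm_exp_notMem he hp0 hs ζ.2⟩, by
      refine Continuous.subtype_mk ?_ _
      exact e.continuousOn_symm.comp_continuous (continuous_exp.comp continuous_subtype_val)
        fun ζ => exp_mem_of_re_lt hs ζ.2⟩
  obtain ⟨Φ, ⟨h1, h2⟩, -⟩ := F.isCovering.existsUnique_continuousMap_lifts f ⟨ζ₀, hζ₀⟩ x₀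
    (Subtype.ext hx₀)
  -- The value outside the half-plane is arbitrary.
  refine ⟨fun ζ => if h : ζ.re < c then Φ ⟨ζ, h⟩ else x₀, ⟨?_, ?_⟩, ?_⟩
  · rw [continuousOn_iff_continuous_domRestrict]
    convert Φ.continuous using 1
    funext ζ
    have : (ζ : ℂ).re < c := ζ.2
    simp [this]
  · intro ζ hζ
    have := congrArg Subtype.val (congrFun h2 ⟨ζ, hζ⟩)
    simp only [hζ, dif_pos]
    exact this
  · simp [hζ₀, h1]

lemma IsLogLift.eqOn {φ φ' : ℂ → F.cover} (h : IsLogLift F e c φ) (h' : IsLogLift F e c φ')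
    {ζ₀ : ℂ} (hζ₀ : ζ₀.re < c) (h0 : φ ζ₀ = φ' ζ₀) : EqOn φ φ' {ζ | ζ.re < c} :=
  F.isCovering.eqOn_of_comp_eqOn (convex_leftHalfPlane c).isPreconnected h.1 h'.1
    (fun ζ hζ => Subtype.ext ((h.2 ζ hζ).trans (h'.2 ζ hζ).symm)) hζ₀ h0

lemma IsLogLift.comp_add {φ : ℂ → F.cover} (h : IsLogLift F e c φ) (k : ℤ) :
    IsLogLift F e c fun ζ => φ (ζ + k * (2 * Real.pi * I)) := by
  have hre : ∀ ζ : ℂ, (ζ + k * (2 * Real.pi * I)).re = ζ.re := by intro ζ; simp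
  refine ⟨h.1.comp (by fun_prop) fun ζ hζ => ?_, fun ζ hζ => ?_⟩
  · change (ζ + k * (2 * Real.pi * I)).re < c
    rwa [hre]
  · rw [h.2 _ (by rwa [hre]), exp_add, exp_int_mul_two_pi_mul_I, mul_one]

/-- A branch of the logarithm near `exp ζ` with the value `ζ` at `exp ζ`. -/
def logNear (ζ z : ℂ) : ℂ := ζ + log (z / exp ζ)

lemma logNear_exp (ζ : ℂ) : logNear ζ (exp ζ) = ζ := by
  simp [logNear]

lemma continuousAt_logNear (ζ : ℂ) : ContinuousAt (logNear ζ) (exp ζ) := by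
  refine continuousAt_const.add (ContinuousAt.clog (by fun_prop) ?_)
  rw [div_self (exp_ne_zero ζ)]
  exact one_mem_slitPlane

lemma eventually_continuousAt_logNear (ζ : ℂ) :
    ∀ᶠ z in 𝓝 (exp ζ), ContinuousAt (logNear ζ) z := by
  have h : ∀ᶠ z in 𝓝 (exp ζ), z / exp ζ ∈ slitPlane :=
    (by fun_prop : ContinuousAt (fun z => z / exp ζ) (exp ζ)).eventually
      (isOpen_slitPlane.mem_nhds (by simp [one_mem_slitPlane]))
  filter_upwards [h] with z hz
  exact continuousAt_const.add (ContinuousAt.clog (by fun_prop) hz)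

lemma exp_logNear {ζ z : ℂ} (hz : z ≠ 0) : exp (logNear ζ z) = z := by
  rw [logNear, exp_add, exp_log (div_ne_zero hz (exp_ne_zero ζ)),
    mul_div_cancel₀ _ (exp_ne_zero ζ)]

lemma tendsto_logNear_coord (hs : Metric.ball 0 (Real.exp c) ⊆ e.target) {φ : ℂ → F.cover}
    (h : IsLogLift F e c φ) {ζ : ℂ} (hζ : ζ.re < c) :
    Tendsto (fun y => logNear ζ (e (F.proj y))) (𝓝 (φ ζ)) (𝓝 ζ) := by
  have hmem := exp_mem_of_re_lt hs hζ
  have h1 : Tendsto (fun y : F.cover => e (F.proj y)) (𝓝 (φ ζ)) (𝓝 (exp ζ)) := by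
    have h2 : ContinuousAt e (F.proj (φ ζ) : M) := by
      rw [h.2 ζ hζ]; exact e.continuousAt (e.map_target hmem)
    have h3 := h2.tendsto.comp (F.continuous_coe_proj.tendsto (φ ζ))
    rwa [h.2 ζ hζ, e.right_inv hmem] at h3
  have h4 := (continuousAt_logNear ζ).tendsto.comp h1
  rwa [logNear_exp] at h4

/-- A lift is inverted near `φ ζ` by the branch of the logarithm of the coordinate. -/
lemma IsLogLift.eventually_apply_logNear (hs : Metric.ball 0 (Real.exp c) ⊆ e.target)
    {φ : ℂ → F.cover} (h : IsLogLift F e c φ) {ζ : ℂ} (hζ : ζ.re < c) :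
    ∀ᶠ y in 𝓝 (φ ζ), (logNear ζ (e (F.proj y))).re < c ∧ φ (logNear ζ (e (F.proj y))) = y := by
  have hmem := exp_mem_of_re_lt hs hζ
  have hlim := tendsto_logNear_coord hs h hζ
  have hlt : ∀ᶠ y in 𝓝 (φ ζ), (logNear ζ (e (F.proj y))).re < c :=
    hlim.eventually ((isOpen_leftHalfPlane c).mem_nhds hζ)
  have hφ : ContinuousAt φ ζ := h.1.continuousAt ((isOpen_leftHalfPlane c).mem_nhds hζ)
  obtain ⟨T, hT, hTeq⟩ := F.isCovering.isLocalHomeomorph (φ ζ)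
  have hU : T.source ∈ 𝓝 (φ ζ) := T.open_source.mem_nhds hT
  have hsrc : ∀ᶠ y in 𝓝 (φ ζ), (F.proj y : M) ∈ e.source :=
    F.continuous_coe_proj.continuousAt.eventually
      (by simp only [h.2 ζ hζ]; exact e.open_source.mem_nhds (e.map_target hmem))
  have hne0 : ∀ᶠ y in 𝓝 (φ ζ), e (F.proj y) ≠ 0 := by
    have h2 : ContinuousAt (fun y : F.cover => e (F.proj y)) (φ ζ) := by
      refine ContinuousAt.comp (f := fun y : F.cover => (F.proj y : M)) (g := e) ?_
        F.continuous_coe_proj.continuousAt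
      rw [h.2 ζ hζ]; exact e.continuousAt (e.map_target hmem)
    refine h2.eventually_ne ?_
    rw [h.2 ζ hζ, e.right_inv hmem]
    exact exp_ne_zero ζ
  filter_upwards [hlt, (hφ.tendsto.comp hlim).eventually hU, hU, hsrc, hne0] with y h1 h2 h3 h4 h5
  refine ⟨h1, T.injOn h2 h3 ?_⟩
  have h6 : F.proj (φ (logNear ζ (e (F.proj y)))) = F.proj y :=
    Subtype.ext (by rw [h.2 _ h1, exp_logNear h5, e.left_inv h4])
  have h7 : ∀ y, T y = F.proj y := fun y => congrFun hTeq.symm y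
  rw [h7, h7]
  exact h6

/-- The component through `x₀` of the part of the covering over a subset of the punctured disk is
contained in the image of any lift through `x₀`. -/
theorem IsLogLift.exists_eq_of_mem_connectedComponentIn (he : e.source ∩ S ⊆ {p})
    (hp0 : e p = 0) (hs : Metric.ball 0 (Real.exp c) ⊆ e.target) {U : Set M}
    (hU : ∀ q ∈ U, q ∉ S → ∃ ζ : ℂ, ζ.re < c ∧ q = e.symm (exp ζ)) {φ : ℂ → F.cover}
    (h : IsLogLift F e c φ) {ζ₀ : ℂ} (hζ₀ : ζ₀.re < c) (hx₀ : (F.proj (φ ζ₀) : M) ∈ U)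
    {x : F.cover}
    (hx : x ∈ connectedComponentIn {y : F.cover | (F.proj y : M) ∈ U} (φ ζ₀)) :
    ∃ ζ : ℂ, ζ.re < c ∧ φ ζ = x := by
  have hopen : ∀ φ : ℂ → F.cover, IsLogLift F e c φ → IsOpen (φ '' {ζ | ζ.re < c}) := by
    intro φ h
    rw [isOpen_iff_mem_nhds]
    rintro _ ⟨ζ, hζ, rfl⟩
    filter_upwards [h.eventually_apply_logNear hs hζ] with y hy
    exact ⟨_, hy.1, hy.2⟩
  -- Images of lifts are open. The union of those disjoint from the image of `φ` is therefore an
  -- open set separated from it, and the two together cover the component.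
  set O : Set F.cover := ⋃ φ' ∈ {φ' : ℂ → F.cover | IsLogLift F e c φ' ∧
    Disjoint (φ '' {ζ | ζ.re < c}) (φ' '' {ζ | ζ.re < c})}, φ' '' {ζ | ζ.re < c} with hO
  have hOo : IsOpen O := isOpen_biUnion fun φ' hφ' => hopen φ' hφ'.1
  have hdisj : Disjoint (φ '' {ζ | ζ.re < c}) O := by
    rw [hO]
    simp only [disjoint_iUnion_right]
    exact fun φ' hφ' => hφ'.2
  have hcover : connectedComponentIn {y : F.cover | (F.proj y : M) ∈ U} (φ ζ₀) ⊆
      φ '' {ζ | ζ.re < c} ∪ O := by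
    intro y hy
    have hyU : (F.proj y : M) ∈ U := (connectedComponentIn_subset {y : F.cover | (F.proj y : M) ∈ U} _ hy :)
    obtain ⟨ζ₁, hζ₁, hyζ⟩ := hU _ hyU (F.proj y).2
    obtain ⟨φ', hφ', hφy⟩ := exists_isLogLift he hp0 hs y hζ₁ hyζ
    by_cases hd : Disjoint (φ '' {ζ | ζ.re < c}) (φ' '' {ζ | ζ.re < c})
    · right
      exact mem_biUnion (show φ' ∈ {φ' : ℂ → F.cover | _} from ⟨hφ', hd⟩) ⟨ζ₁, hζ₁, hφy⟩
    · left
      -- Two lifts that meet differ by a shift of the variable by a multiple of `2πi`, by uniqueness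
      -- of lifts, and so have the same image.
      obtain ⟨_, ⟨ζ₂, hζ₂, rfl⟩, ⟨ζ₃, hζ₃, h23⟩⟩ := not_disjoint_iff.1 hd
      have h1 : exp ζ₂ = exp ζ₃ := by
        refine e.symm.injOn (exp_mem_of_re_lt hs hζ₂) (exp_mem_of_re_lt hs hζ₃) ?_
        rw [← h.2 ζ₂ hζ₂, ← hφ'.2 ζ₃ hζ₃, h23]
      obtain ⟨k, hk⟩ := exp_eq_exp_iff_exists_int.1 h1
      have h2 := hφ'.eqOn (h.comp_add k) hζ₃ (by rw [h23, hk])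
      refine ⟨ζ₁ + k * (2 * Real.pi * I), ?_, ?_⟩
      · simpa using hζ₁
      · rw [← hφy]; exact (h2 hζ₁).symm
  have hmem : φ ζ₀ ∈ connectedComponentIn {y : F.cover | (F.proj y : M) ∈ U} (φ ζ₀) :=
    mem_connectedComponentIn hx₀
  obtain ⟨ζ, hζ, hζx⟩ := isPreconnected_connectedComponentIn.subset_left_of_subset_union
    (hopen φ h) hOo hdisj hcover ⟨φ ζ₀, hmem, ζ₀, hζ₀, rfl⟩ hx
  exact ⟨ζ, hζ, hζx⟩

/-- Along a lift, `F` is the composition of a function element with `e⁻¹ ∘ exp`. -/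
lemma IsLogLift.toFun_eventuallyEq {φ : ℂ → F.cover} (h : IsLogLift F e c φ) {ζ : ℂ}
    (hζ : ζ.re < c) {g : M → ℂ} (hg : IsElement F (φ ζ) g) :
    (fun w => F.toFun (φ w)) =ᶠ[𝓝 ζ] (g ∘ e.symm) ∘ exp := by
  have hφ : ContinuousAt φ ζ := h.1.continuousAt ((isOpen_leftHalfPlane c).mem_nhds hζ)
  filter_upwards [hφ.eventually hg, (isOpen_leftHalfPlane c).mem_nhds hζ] with w hw hwc
  rw [hw, h.2 w hwc]
  rfl

variable [ChartedSpace ℂ M]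

lemma IsLocallyUnivalent.exists_element (hF : IsLocallyUnivalent F) (he : IsCoord e)
    (hs : Metric.ball 0 (Real.exp c) ⊆ e.target) {φ : ℂ → F.cover} (h : IsLogLift F e c φ) {ζ : ℂ}
    (hζ : ζ.re < c) : ∃ g : M → ℂ, IsElement F (φ ζ) g ∧
      AnalyticAt ℂ (g ∘ e.symm) (exp ζ) ∧ deriv (g ∘ e.symm) (exp ζ) ≠ 0 := by
  obtain ⟨g, hg, hge⟩ := hF (φ ζ)
  have hmem := exp_mem_of_re_lt hs hζ
  have h1 := hge e he (by rw [h.2 ζ hζ]; exact e.map_target hmem)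
  rw [h.2 ζ hζ, e.right_inv hmem] at h1
  exact ⟨g, hg, h1⟩

lemma IsLogLift.analyticAt (hF : IsLocallyUnivalent F) (he : IsCoord e)
    (hs : Metric.ball 0 (Real.exp c) ⊆ e.target) {φ : ℂ → F.cover} (h : IsLogLift F e c φ) {ζ : ℂ}
    (hζ : ζ.re < c) : AnalyticAt ℂ (fun w => F.toFun (φ w)) ζ := by
  obtain ⟨g, hg, hga, -⟩ := hF.exists_element he hs h hζ
  exact (hga.comp analyticAt_cexp).congr (h.toFun_eventuallyEq hζ hg).symm

lemma IsLogLift.deriv_ne_zero (hF : IsLocallyUnivalent F) (he : IsCoord e)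
    (hs : Metric.ball 0 (Real.exp c) ⊆ e.target) {φ : ℂ → F.cover} (h : IsLogLift F e c φ) {ζ : ℂ}
    (hζ : ζ.re < c) : deriv (fun w => F.toFun (φ w)) ζ ≠ 0 := by
  obtain ⟨g, hg, hga, hgd⟩ := hF.exists_element he hs h hζ
  rw [(h.toFun_eventuallyEq hζ hg).deriv_eq,
    deriv_comp ζ hga.differentiableAt differentiableAt_exp]
  exact mul_ne_zero hgd (by simp [exp_ne_zero])

/-- Two lifts whose function elements at one point are related are related everywhere. -/
theorem IsLogLift.smul_eq_of_related (hF : IsLocallyUnivalent F) (he : IsCoord e)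
    (hs : Metric.ball 0 (Real.exp c) ⊆ e.target) {φ φ' : ℂ → F.cover} (h : IsLogLift F e c φ)
    (h' : IsLogLift F e c φ') {ζ₀ : ℂ} (hζ₀ : ζ₀.re < c) {L : GL (Fin 2) ℂ}
    (hL : ElementsRelated F (φ' ζ₀) (φ ζ₀) L) {ζ : ℂ} (hζ : ζ.re < c) :
    L • (F.toFun (φ ζ) : OnePoint ℂ) = (F.toFun (φ' ζ) : OnePoint ℂ) := by
  have hmem := exp_mem_of_re_lt hs hζ₀
  obtain ⟨g, hg, -, -⟩ := hF.exists_element he hs h hζ₀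
  obtain ⟨g', hg', -, -⟩ := hF.exists_element he hs h' hζ₀
  have hrel := hL g' g hg' hg
  rw [h'.2 ζ₀ hζ₀] at hrel
  have hcont : ContinuousAt (fun w => e.symm (exp w)) ζ₀ :=
    ContinuousAt.comp (g := e.symm) (e.continuousAt_symm hmem) continuous_exp.continuousAt
  have hev : ∀ᶠ w in 𝓝 ζ₀,
      L • (F.toFun (φ w) : OnePoint ℂ) = (F.toFun (φ' w) : OnePoint ℂ) := by
    filter_upwards [hcont.eventually hrel, h.toFun_eventuallyEq hζ₀ hg,
      h'.toFun_eventuallyEq hζ₀ hg'] with w hw h1 h2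
    rw [h1, h2]
    exact hw.symm
  have ha : AnalyticOnNhd ℂ (fun w => F.toFun (φ w)) {ζ | ζ.re < c} :=
    fun w hw => h.analyticAt hF he hs hw
  have ha' : AnalyticOnNhd ℂ (fun w => F.toFun (φ' w)) {ζ | ζ.re < c} :=
    fun w hw => h'.analyticAt hF he hs hw
  have heq := AnalyticOnNhd.eqOn_of_preconnected_of_eventuallyEq
    (f := fun w => L 0 0 * F.toFun (φ w) + L 0 1)
    (g := fun w => F.toFun (φ' w) * (L 1 0 * F.toFun (φ w) + L 1 1))
    (fun w hw => (analyticAt_const.mul (ha w hw)).add analyticAt_const)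
    (fun w hw => (ha' w hw).mul ((analyticAt_const.mul (ha w hw)).add analyticAt_const))
    (convex_leftHalfPlane c).isPreconnected hζ₀
    (hev.mono fun w hw => (smul_coe_eq_coe_iff.1 hw).2) hζ
  -- If the denominator vanished, the identity just extended would make the numerator vanish too,
  -- contrary to the invertibility of `L`.
  refine smul_coe_eq_coe_iff.2 ⟨fun h0 => ?_, heq⟩
  dsimp only at heq
  rw [h0, mul_zero] at heq
  refine gl_det_ne_zero L ?_
  by_cases hc : L 1 0 = 0
  · rw [hc, zero_mul, zero_add] at h0
    rw [h0, hc]; ring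
  · have : L 1 0 * (L 0 0 * L 1 1 - L 0 1 * L 1 0) = 0 := by
      linear_combination L 1 0 * (L 0 0 * h0 - L 1 0 * heq)
    exact (mul_eq_zero.1 this).resolve_left hc

end LogLift

/-! ### The pullback metric -/

/-- For a real matrix of determinant `1`, both `Im` and the norm of a tangent vector are divided by
`|c w + d|²`. Positivity of `Im w` is not required: on the real line both sides are `0` by the
convention `1 / 0 = 0`. -/
lemma halfPlaneDensity_moebius {L : GL (Fin 2) ℂ} (hL : L ∈ PSL2R) {w w' : ℂ}
    (hw : L 1 0 * w + L 1 1 ≠ 0) :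
    halfPlaneDensity (moebius L w) *
      ‖(L 0 0 * L 1 1 - L 0 1 * L 1 0) * w' / (L 1 0 * w + L 1 1) ^ 2‖ ^ 2 =
      halfPlaneDensity w * ‖w'‖ ^ 2 := by
  obtain ⟨a, b, c, d, hdet, hLM⟩ := hL
  have h00 : L 0 0 = a := by rw [hLM]; rfl
  have h01 : L 0 1 = b := by rw [hLM]; rfl
  have h10 : L 1 0 = c := by rw [hLM]; rfl
  have h11 : L 1 1 = d := by rw [hLM]; rfl
  rw [h10, h11] at hw
  have hdetC : (a * d - b * c : ℂ) = 1 := by exact_mod_cast hdet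
  have him : (moebius L w).im = w.im / ‖(c * w + d : ℂ)‖ ^ 2 := by
    have h1 : moebius L w = (a * w + b) * conj (c * w + d) / (normSq (c * w + d) : ℝ) := by
      rw [moebius, h00, h01, h10, h11, normSq_eq_conj_mul_self]
      have : conj (c * w + d : ℂ) ≠ 0 := (map_ne_zero _).2 hw
      rw [mul_comm (conj (c * w + d : ℂ)), mul_div_mul_right _ _ this]
    rw [h1, div_ofReal_im, normSq_eq_norm_sq]
    congr 1
    simp
    linear_combination w.im * hdet
  have hn := norm_pos_iff.2 hw
  rw [h00, h01, h10, h11, hdetC, halfPlaneDensity, halfPlaneDensity, him, one_mul, norm_div,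
    norm_pow]
  by_cases h0 : w.im = 0
  · simp [h0]
  · field_simp

section Metric

variable {M : Type u} [TopologicalSpace M] [ChartedSpace ℂ M] {S : Set M}
  {F : MultivaluedFunction.{u, v} M S}

omit [ChartedSpace ℂ M] in
lemma eventually_symm {e : OpenPartialHomeomorph M ℂ} {q : M} (hq : q ∈ e.source) {P : M → Prop}
    (h : ∀ᶠ r in 𝓝 q, P r) : ∀ᶠ z in 𝓝 (e q), P (e.symm z) :=
  (e.tendsto_symm hq).eventually h

omit [ChartedSpace ℂ M] in
lemma pullback_eq_of_related {x y : F.cover} {g g' : M → ℂ} (hxy : F.proj x = F.proj y)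
    (hg : IsElement F x g) (hg' : IsElement F y g') {L : GL (Fin 2) ℂ} (hL : L ∈ PSL2R)
    (hrel : ElementsRelated F y x L) {e : OpenPartialHomeomorph M ℂ}
    (hx : (F.proj x : M) ∈ e.source) (hga : AnalyticAt ℂ (g ∘ e.symm) (e (F.proj x))) :
    halfPlaneDensity (F.toFun y) * ‖deriv (g' ∘ e.symm) (e (F.proj x))‖ ^ 2 =
      halfPlaneDensity (F.toFun x) * ‖deriv (g ∘ e.symm) (e (F.proj x))‖ ^ 2 := by
  have h1 := hrel g' g hg' hg
  rw [← hxy] at h1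
  have h2 : ∀ᶠ q in 𝓝 (F.proj x : M), L 1 0 * g q + L 1 1 ≠ 0 ∧ g' q = moebius L (g q) :=
    h1.mono fun q hq => smul_coe_eq_coe_iff_moebius.1 hq.symm
  have h3 : g' ∘ e.symm =ᶠ[𝓝 (e (F.proj x))] moebius L ∘ (g ∘ e.symm) :=
    (eventually_symm hx h2).mono fun z hz => hz.2
  have h4 := h2.self_of_nhds
  have h5 : (g ∘ e.symm) (e (F.proj x)) = g (F.proj x) := by simp [hx]
  rw [h3.deriv_eq, (hasDerivAt_moebius_comp L hga.differentiableAt.hasDerivAt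
    (by rw [h5]; exact h4.1)).deriv, h5, hg'.self, ← hxy, h4.2, halfPlaneDensity_moebius hL h4.1,
    hg.self]

open Classical in
/-- The density of the pullback of the metric of the upper half-plane by some branch of `F`. -/
def pullbackDensity (F : MultivaluedFunction.{u, v} M S) (hF : IsLocallyUnivalent F)
    (e : OpenPartialHomeomorph M ℂ) (q : M) : ℝ :=
  if h : q ∈ Sᶜ then
    halfPlaneDensity (F.toFun (F.surjective ⟨q, h⟩).choose) *
      ‖deriv ((hF (F.surjective ⟨q, h⟩).choose).choose ∘ e.symm) (e q)‖ ^ 2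
  -- An arbitrary value: the conditions on a conformal metric concern only points outside `S`.
  else 1

/-- The branch chosen in the definition and the given one are related by an element of `PSL2R`, an
isometry; hence the choice does not matter. -/
lemma pullbackDensity_eq (hF : IsLocallyUnivalent F) (hmon : MonodromyIn F PSL2R)
    (hS : IsClosed S) {e : OpenPartialHomeomorph M ℂ} (he : IsCoord e) {x : F.cover} {g : M → ℂ}
    (hx : (F.proj x : M) ∈ e.source) (hg : IsElement F x g) :
    pullbackDensity F hF e (F.proj x) =
      halfPlaneDensity (F.toFun x) * ‖deriv (g ∘ e.symm) (e (F.proj x))‖ ^ 2 := by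
  rw [pullbackDensity, dif_pos (F.proj x).2]
  set y := (F.surjective ⟨(F.proj x : M), (F.proj x).2⟩).choose with hy
  have hxy : F.proj y = F.proj x := (F.surjective ⟨(F.proj x : M), (F.proj x).2⟩).choose_spec
  obtain ⟨L, hL, hrel⟩ := hmon.exists_related hxy.symm
  obtain ⟨g₀, hg₀, hga⟩ := hF x
  have hgg : g ∘ e.symm =ᶠ[𝓝 (e (F.proj x))] g₀ ∘ e.symm :=
    eventually_symm hx (hg.eventuallyEq hS hg₀)
  exact pullback_eq_of_related hxy.symm hg (hF y).choose_spec.1 hL hrel hx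
    ((hga e he hx).1.congr hgg.symm)

lemma exists_element_at (hF : IsLocallyUnivalent F) {e : OpenPartialHomeomorph M ℂ}
    (he : IsCoord e) {q : M} (hq : q ∈ e.source) (hqS : q ∉ S) :
    ∃ (x : F.cover) (g : M → ℂ), (F.proj x : M) = q ∧ IsElement F x g ∧
      AnalyticAt ℂ (g ∘ e.symm) (e q) ∧ deriv (g ∘ e.symm) (e q) ≠ 0 := by
  obtain ⟨x, hx⟩ := F.surjective ⟨q, hqS⟩
  have hx' : (F.proj x : M) = q := by rw [hx]
  obtain ⟨g, hg, hge⟩ := hF x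
  have := hge e he (by rwa [hx'])
  rw [hx'] at this
  exact ⟨x, g, hx', hg, this⟩

/-- Neighbouring points lift to points with the same function element, so a single `g` describes the
density near `q`. Smoothness and curvature are read off from this formula. -/
lemma pullbackDensity_eventuallyEq (hF : IsLocallyUnivalent F) (hmon : MonodromyIn F PSL2R)
    (hS : IsClosed S) {e : OpenPartialHomeomorph M ℂ} (he : IsCoord e) {x : F.cover} {g : M → ℂ}
    (hx : (F.proj x : M) ∈ e.source) (hg : IsElement F x g) :
    pullbackDensity F hF e ∘ e.symm =ᶠ[𝓝 (e (F.proj x))]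
      fun z => halfPlaneDensity ((g ∘ e.symm) z) * ‖deriv (g ∘ e.symm) z‖ ^ 2 := by
  filter_upwards [eventually_symm hx (hg.eventually_exists hS),
    e.open_target.mem_nhds (e.map_source hx)] with z hz hzt
  obtain ⟨y, hyz, hyg⟩ := hz
  have h1 := pullbackDensity_eq hF hmon hS he (by rw [hyz]; exact e.map_target hzt) hyg
  rw [hyg.self, hyz, e.right_inv hzt] at h1
  exact h1

lemma contDiffAt_halfPlaneDensity_mul {G : ℂ → ℂ} {z : ℂ} (hG : AnalyticAt ℂ G z)
    (him : 0 < (G z).im) :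
    ContDiffAt ℝ ∞ (fun z => halfPlaneDensity (G z) * ‖deriv G z‖ ^ 2) z :=
  (contDiffAt_const.div ((contDiffAt_im hG ⊤).pow 2) (pow_ne_zero 2 him.ne')).mul
    ((analyticAt_contDiffAt_real hG.deriv ⊤).norm_sq ℝ)

/-- The pullback by `F` of the metric of the upper half-plane. -/
def pullbackMetric [IsManifold 𝓘(ℂ) ω M] (F : MultivaluedFunction.{u, v} M S)
    (hF : IsLocallyUnivalent F) (hmon : MonodromyIn F PSL2R) (hS : IsClosed S)
    (him : ∀ x, 0 < (F.toFun x).im) : ConformalMetric M S where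
  density := pullbackDensity F hF
  pos e he q hq := by
    obtain ⟨x, g, rfl, hg, -, hgd⟩ := exists_element_at hF he hq.1 hq.2
    rw [pullbackDensity_eq hF hmon hS he hq.1 hg]
    have h1 := him x
    have h2 := norm_pos_iff.2 hgd
    rw [halfPlaneDensity]
    positivity
  smooth e he z hz := by
    obtain ⟨x, g, hx, hg, hga, -⟩ := exists_element_at hF he (e.map_target hz.1) hz.2
    have hxe : (F.proj x : M) ∈ e.source := by rw [hx]; exact e.map_target hz.1
    have h1 := pullbackDensity_eventuallyEq hF hmon hS he hxe hg
    rw [hx] at h1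
    rw [e.right_inv hz.1] at h1 hga
    refine ((contDiffAt_halfPlaneDensity_mul hga ?_).congr_of_eventuallyEq h1).contDiffWithinAt
    rw [Function.comp_apply, ← hx, ← hg.self]
    exact him x
  transform e e' he he' q hq := by
    obtain ⟨x, g, rfl, hg, hga, hgd⟩ := exists_element_at hF he' hq.1.2 hq.2
    rw [pullbackDensity_eq hF hmon hS he hq.1.1 hg, pullbackDensity_eq hF hmon hS he' hq.1.2 hg]
    have h1 : g ∘ e.symm =ᶠ[𝓝 (e (F.proj x))] (g ∘ e'.symm) ∘ (e' ∘ e.symm) := by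
      filter_upwards [eventually_symm hq.1.1 (e'.open_source.mem_nhds hq.1.2)] with z hz
      simp [e'.left_inv hz]
    have h2 : (e' ∘ e.symm) (e (F.proj x)) = e' (F.proj x) := by simp [hq.1.1]
    rw [h1.deriv_eq, deriv_comp _ (by rw [h2]; exact hga.differentiableAt)
      (he.analyticAt_comp_symm he' hq.1.1 hq.1.2).differentiableAt, h2, norm_mul]
    ring

variable [IsManifold 𝓘(ℂ) ω M] (hF : IsLocallyUnivalent F) (hmon : MonodromyIn F PSL2R)
  (hS : IsClosed S) (him : ∀ x, 0 < (F.toFun x).im)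

lemma pullbackMetric_isPullback :
    (pullbackMetric F hF hmon hS him).IsPullback F halfPlaneDensity :=
  fun _ he _ _ hx hg => pullbackDensity_eq hF hmon hS he hx hg

lemma pullbackMetric_isHyperbolic : (pullbackMetric F hF hmon hS him).IsHyperbolic := by
  intro e he q hq
  obtain ⟨x, g, rfl, hg, hga, hgd⟩ := exists_element_at hF he hq.1 hq.2
  have hev := pullbackDensity_eventuallyEq hF hmon hS he hq.1 hg
  have hev' : (pullbackMetric F hF hmon hS him).logDensity e ∘ e.symm =ᶠ[𝓝 (e (F.proj x))]
      fun z => 1 / 2 *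
        Real.log (halfPlaneDensity ((g ∘ e.symm) z) * ‖deriv (g ∘ e.symm) z‖ ^ 2) :=
    hev.mono fun z hz => by
      simp only [Function.comp_apply, ConformalMetric.logDensity] at hz ⊢
      rw [← hz]; rfl
  have him' : 0 < ((g ∘ e.symm) (e (F.proj x))).im := by
    simp only [Function.comp_apply, e.left_inv hq.1, ← hg.self, him x]
  have hpos := (pullbackMetric F hF hmon hS him).pos e he _ hq
  have hval : (pullbackMetric F hF hmon hS him).density e (F.proj x) =
      halfPlaneDensity ((g ∘ e.symm) (e (F.proj x))) * ‖deriv (g ∘ e.symm) (e (F.proj x))‖ ^ 2 := by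
    have := hev.self_of_nhds
    rwa [Function.comp_apply, e.left_inv hq.1] at this
  rw [ConformalMetric.curvature, (InnerProductSpace.laplacian_congr_nhds hev').eq_of_nhds,
    laplacian_log_pullback hga him' hgd, ← hval, div_self hpos.ne']

end Metric

/-! ### Local form of the function and of the metric at a singular point -/

section LocalModel

variable {M : Type u} [TopologicalSpace M] [ChartedSpace ℂ M] {S : Set M}
  {F : MultivaluedFunction.{u, v} M S} {p : M}

/-- The lift of the logarithm of a coordinate at a singular point, with the local model of `F`
along it. -/
theorem exists_isLogLift_hasModel (hF : IsLocallyUnivalent F) (hmon : MonodromyIn F PSL2R)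
    (him : ∀ x, 0 < (F.toFun x).im) {θ : ℝ} (hθ : 0 ≤ θ) (h : SchwarzianForm F p θ) :
    ∃ (e : OpenPartialHomeomorph M ℂ) (c : ℝ) (φ : ℂ → F.cover), IsCenteredCoord S p e ∧
      Metric.ball 0 (Real.exp c) ⊆ e.target ∧ IsLogLift F e c φ ∧
      (0 < θ → HasModel (fun w => exp (θ * w)) (coneProfile θ) fun w => F.toFun (φ w)) ∧
      (θ = 0 → HasModel (fun w => w) cuspProfile fun w => F.toFun (φ w)) := by
  obtain ⟨e, ⟨he, hp, hp0, heS⟩, d, ϕ, hϕ, hform⟩ := h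
  have h0t : (0 : ℂ) ∈ e.target := hp0 ▸ e.map_source hp
  obtain ⟨r, hr, hrt⟩ := Metric.isOpen_iff.1 e.open_target 0 h0t
  obtain ⟨c, hs⟩ : ∃ c : ℝ, Metric.ball 0 (Real.exp c) ⊆ e.target :=
    ⟨Real.log r, by rwa [Real.exp_log hr]⟩
  set ζ₀ : ℂ := ((c - 1 : ℝ) : ℂ)
  have hζ₀ : ζ₀.re < c := by simp [ζ₀]
  obtain ⟨x₀, hx₀⟩ := F.surjective ⟨e.symm (exp ζ₀), symm_exp_notMem heS hp0 hs hζ₀⟩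
  obtain ⟨φ, hφ, -⟩ := exists_isLogLift heS hp0 hs x₀ hζ₀ (by rw [hx₀])
  refine ⟨e, c, φ, ⟨he, hp, hp0, heS⟩, hs, hφ, ?_⟩
  -- The shift by one period is one turn around `p`. The shifted lift lies over the same points, so
  -- `F` along it is an element of `PSL2R` applied to `F` along `φ`.
  have hφ' := hφ.comp_add 1
  have hpr : F.proj (φ ζ₀) = F.proj (φ (ζ₀ + (1 : ℤ) * (2 * Real.pi * I))) :=
    Subtype.ext ((hφ.2 ζ₀ hζ₀).trans (hφ'.2 ζ₀ hζ₀).symm)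
  obtain ⟨L, hLΓ, hrel⟩ := hmon.exists_related hpr
  have hper := fun (ζ : ℂ) (hζ : ζ.re < c) =>
    smul_coe_eq_coe_iff.1 (hφ.smul_eq_of_related hF he hs hφ' hζ₀ hrel hζ)
  obtain ⟨A, B, C, D, hdet, hLM⟩ := hLΓ
  have h00 : L 0 0 = A := by rw [hLM]; rfl
  have h01 : L 0 1 = B := by rw [hLM]; rfl
  have h10 : L 1 0 = C := by rw [hLM]; rfl
  have h11 : L 1 1 = D := by rw [hLM]; rfl
  refine HasModel.of_tendsto_schwarzian hθ (hasModel_of_monodromy (k := c)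
    (fun ζ hζ => (hφ.analyticAt hF he hs hζ).differentiableAt.differentiableWithinAt)
    (fun ζ _ => him _) (fun ζ hζ => hφ.deriv_ne_zero hF he hs hζ) hdet ?_) ?_
  · intro ζ hζ
    have := (hper ζ hζ).2
    rw [h00, h01, h10, h11] at this
    simp only [Int.cast_one, one_mul] at this
    linear_combination -this
  · refine tendsto_schwarzian_of_form (c := c) (d := d)
      (hϕ.differentiableAt (e.open_target.mem_nhds h0t)).continuousAt fun ζ hζ => ?_
    obtain ⟨g, hg, hga, hgd⟩ := hF.exists_element he hs hφ hζ
    have hmem := exp_mem_of_re_lt hs hζ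
    have h1 := hform (φ ζ) g (by rw [hφ.2 ζ hζ]; exact e.map_target hmem) hg
    rw [hφ.2 ζ hζ, e.right_inv hmem] at h1
    exact ⟨g ∘ e.symm, hga, hgd, hφ.toFun_eventuallyEq hζ hg, h1⟩

/-- A coordinate in which `F` and the pullback metric have the form of the local model. -/
theorem HasModel.exists_coord (hF : IsProjective F) (hS : p ∈ S)
    {e : OpenPartialHomeomorph M ℂ} {c : ℝ} {φ : ℂ → F.cover} (he : IsCenteredCoord S p e)
    (hs : Metric.ball 0 (Real.exp c) ⊆ e.target) (hφ : IsLogLift F e c φ)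
    {Φ : ℂ → ℂ} {Ψ : ℝ → ℝ} (hm : HasModel Φ Ψ fun w => F.toFun (φ w)) :
    ∃ e' : OpenPartialHomeomorph M ℂ, IsCenteredCoord S p e' ∧ IsConnected e'.source ∧
      (∀ q ∈ e'.source, ‖e' q‖ < 1) ∧
      (∀ x₀ : F.cover, (F.proj x₀ : M) ∈ e'.source → ∃ L : GL (Fin 2) ℂ,
        ∀ x ∈ connectedComponentIn {y : F.cover | (F.proj y : M) ∈ e'.source} x₀,
          ∃ ℓ : M → ℂ, IsLogBranch e' (F.proj x) ℓ ∧
            ∀ᶠ y in 𝓝 x, L • (F.toFun y : OnePoint ℂ) = (Φ (ℓ (F.proj y)) : OnePoint ℂ)) ∧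
      ∀ σ : ConformalMetric M S, σ.IsPullback F halfPlaneDensity → ∀ q ∈ e'.source \ {p},
        σ.density e' q = Ψ (Real.log ‖e' q‖) / ‖e' q‖ ^ 2 := by
  obtain ⟨κ, c₁, T, hκ, hT⟩ := hm
  -- The new coordinate `e exp (κ e)` has logarithm `ζ + κ (exp ζ)`. The radius `exp (min c c₁)`
  -- keeps its domain where both the lift and the model are available.
  obtain ⟨e', he', hconn, hsub, hq⟩ := he.exists_mul_exp hκ (Real.exp_pos (min c c₁))
  obtain ⟨hec, hp, hp0, heS⟩ := he
  have hlog : ∀ q ∈ e'.source, q ∉ S → ∃ ζ : ℂ, ζ.re < min c c₁ ∧ q = e.symm (exp ζ) := by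
    intro q hqs hqS
    have hne : e q ≠ 0 := fun h0 => hqS (by
      rwa [← e.injOn hp (hsub hqs) (hp0.trans h0.symm)])
    refine ⟨log (e q), ?_, by rw [exp_log hne, e.left_inv (hsub hqs)]⟩
    rw [log_re, Real.log_lt_iff_lt_exp (norm_pos_iff.2 hne)]
    exact (hq q hqs).1
  have hlt : ∀ ζ : ℂ, ζ.re < c → e.symm (exp ζ) ∈ e'.source → ζ.re < c₁ := by
    intro ζ hζ hζs
    have := (hq _ hζs).1
    rw [e.right_inv (exp_mem_of_re_lt hs hζ), norm_exp, Real.exp_lt_exp] at this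
    exact this.trans_le (min_le_right _ _)
  refine ⟨e', he', hconn, fun q hqs => (hq q hqs).2.1, ?_, ?_⟩
  · intro x₀ hx₀
    obtain ⟨ζ₀, hζ₀, hx₀ζ⟩ := hlog _ hx₀ (F.proj x₀).2
    have hζ₀c := hζ₀.trans_le (min_le_left _ _)
    obtain ⟨ψ, hψ, hψx⟩ := exists_isLogLift heS hp0 hs x₀ hζ₀c hx₀ζ
    -- The model is known along the lift `φ` only. Projectivity relates the given branch, followed
    -- along `ψ`, to that one, and `T * L` normalizes it.
    obtain ⟨L, hL⟩ := hF.2 (φ ζ₀) (ψ ζ₀)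
      (Subtype.ext ((hφ.2 _ hζ₀c).trans (hψ.2 _ hζ₀c).symm))
    refine ⟨T * L, fun x hx => ?_⟩
    rw [← hψx] at hx hx₀
    have hxs : (F.proj x : M) ∈ e'.source :=
      (connectedComponentIn_subset {y : F.cover | (F.proj y : M) ∈ e'.source} _ hx :)
    obtain ⟨ζ, hζ, rfl⟩ := hψ.exists_eq_of_mem_connectedComponentIn heS hp0 hs
      (fun q hqs hqS => (hlog q hqs hqS).imp fun ζ h => ⟨h.1.trans_le (min_le_left _ _), h.2⟩)
      hζ₀c hx₀ hx
    have hmem := exp_mem_of_re_lt hs hζ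
    have hex : e (F.proj (ψ ζ)) = exp ζ := by rw [hψ.2 ζ hζ, e.right_inv hmem]
    have hζ1 : ζ.re < c₁ := hlt ζ hζ (by rwa [← hψ.2 ζ hζ])
    refine ⟨fun q => logNear ζ (e q) + κ (e q), ?_, ?_⟩
    · have hce : ContinuousAt e (F.proj (ψ ζ) : M) := e.continuousAt (hsub hxs)
      have h1 := eventually_continuousAt_logNear ζ
      have h2 : ∀ᶠ z in 𝓝 (exp ζ), z ≠ 0 := isOpen_ne.mem_nhds (exp_ne_zero ζ)
      rw [← hex] at h1 h2
      filter_upwards [hce.eventually h1, hce.eventually h2, e'.open_source.mem_nhds hxs]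
        with q hq1 hq2 hqs
      refine ⟨?_, ?_⟩
      · have hceq : ContinuousAt e q := e.continuousAt (hsub hqs)
        exact (hq1.comp hceq).add
          (ContinuousAt.comp (g := κ) (hq q hqs).2.2.2.continuousAt hceq)
      · rw [exp_add, exp_logNear hq2, (hq q hqs).2.2.1]
    · filter_upwards [hψ.eventually_apply_logNear hs hζ, (tendsto_logNear_coord hs hψ hζ).eventually
        ((isOpen_leftHalfPlane c₁).mem_nhds hζ1)] with y hy hy1
      set w := logNear ζ (e (F.proj y)) with hw
      have hwe : exp w = e (F.proj y) := by
        rw [← hy.2, hψ.2 w hy.1, e.right_inv (exp_mem_of_re_lt hs hy.1)]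
      have h1 := hψ.smul_eq_of_related hF.1 hec hs hφ hζ₀c hL hy.1
      have h2 := (hT w hy1).1
      rw [hy.2] at h1
      rw [mul_smul, h1, h2, hwe]
  · intro σ hσ q hqs
    have hqS : q ∉ S := fun h => hqs.2 (he'.2.2.2 ⟨hqs.1, h⟩)
    obtain ⟨ζ, hζm, hζq⟩ := hlog q hqs.1 hqS
    have hζ := hζm.trans_le (min_le_left _ _)
    have hζ1 := hζm.trans_le (min_le_right _ _)
    have hmem := exp_mem_of_re_lt hs hζ
    have hxq : (F.proj (φ ζ) : M) = q := by rw [hφ.2 ζ hζ, ← hζq]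
    obtain ⟨g, hg, hge⟩ := hF.1 (φ ζ)
    obtain ⟨hga, -⟩ := hge e' he'.1 (by rw [hxq]; exact hqs.1)
    have hdens := hσ e' he'.1 (φ ζ) g (by rw [hxq]; exact hqs.1) hg
    rw [hxq] at hga hdens
    have heq : e q = exp ζ := by rw [hζq, e.right_inv hmem]
    set η : ℂ → ℂ := fun w => w + κ (exp w) with hη
    have he'q : e' q = exp (η ζ) := by
      rw [(hq q hqs.1).2.2.1, heq, ← exp_add]
    have hηd : HasDerivAt η (deriv η ζ) ζ := by
      have := (hq q hqs.1).2.2.2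
      rw [heq] at this
      exact (hasDerivAt_add_comp_exp this.differentiableAt).differentiableAt.hasDerivAt
    have hcont : ContinuousAt (fun w => e.symm (exp w)) ζ :=
      ContinuousAt.comp (g := e.symm) (e.continuousAt_symm hmem) continuous_exp.continuousAt
    have hev : (fun w => F.toFun (φ w)) =ᶠ[𝓝 ζ] (g ∘ e'.symm) ∘ fun w => exp (η w) := by
      filter_upwards [hφ.toFun_eventuallyEq hζ hg, (isOpen_leftHalfPlane c).mem_nhds hζ,
        hcont.eventually (e'.open_source.mem_nhds (by beta_reduce; rw [← hζq]; exact hqs.1))] with w h1 h2 h3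
      have h4 := (hq _ h3).2.2.1
      rw [e.right_inv (exp_mem_of_re_lt hs h2), ← exp_add] at h4
      rw [h1]
      simp only [Function.comp_apply, hη]
      rw [← h4, e'.left_inv h3]
    rw [he'q] at hga
    have hderiv : deriv (fun w => F.toFun (φ w)) ζ =
        deriv (g ∘ e'.symm) (e' q) * (e' q * deriv η ζ) := by
      rw [hev.deriv_eq, he'q]
      exact (hga.differentiableAt.hasDerivAt.comp ζ hηd.cexp).deriv
    -- Local univalence of `F` excludes zeros of `η'`, so `‖η'‖²` can be cancelled between the two
    -- expressions of the density.
    have hne : deriv η ζ ≠ 0 := by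
      intro h0
      refine hφ.deriv_ne_zero hF.1 hec hs hζ ?_
      rw [hderiv, h0, mul_zero, mul_zero]
    have hnorm : Real.log ‖e' q‖ = (η ζ).re := by rw [he'q, norm_exp, Real.log_exp]
    have he'0 : ‖e' q‖ ≠ 0 := by rw [he'q]; exact norm_ne_zero_iff.2 (exp_ne_zero _)
    have h2 := (hT ζ hζ1).2
    rw [hderiv, norm_mul, norm_mul] at h2
    have h3 := norm_ne_zero_iff.2 hne
    rw [hdens, hnorm, eq_div_iff (pow_ne_zero 2 he'0)]
    refine mul_right_cancel₀ (pow_ne_zero 2 h3) ?_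
    rw [← h2]
    ring

variable {σ : ConformalMetric M S} {e : OpenPartialHomeomorph M ℂ}

/-- The density is `(2θ |z|^(θ-1) / (1 - |z|^(2θ)))²`. What remains of `u` is `log (2θ) - log (1 -
|z|^(2θ))`, continuous at `0` because `θ > 0`. -/
lemma hasCone_of_density {θ : ℝ} (hθ : 0 < θ) (he : IsCenteredCoord S p e)
    (h1 : ∀ q ∈ e.source, ‖e q‖ < 1)
    (hd : ∀ q ∈ e.source \ {p}, σ.density e q =
      coneProfile θ (Real.log ‖e q‖) / ‖e q‖ ^ 2) : σ.HasCone p θ := by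
  have hlt : ∀ q ∈ e.source, ‖e q‖ ^ θ < 1 := fun q hq =>
    Real.rpow_lt_one (norm_nonneg _) (h1 q hq) hθ
  have hpos : ∀ q ∈ e.source, 0 < 1 - (‖e q‖ ^ θ) ^ 2 := fun q hq => by
    have h2 := Real.rpow_nonneg (norm_nonneg (e q)) θ
    have h3 := hlt q hq
    nlinarith
  refine ⟨e, he, fun q => Real.log (2 * θ) - Real.log (1 - (‖e q‖ ^ θ) ^ 2), ?_, ?_⟩
  · refine continuousOn_const.sub (ContinuousOn.log ?_ fun q hq => (hpos q hq).ne')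
    exact continuousOn_const.sub
      ((e.continuousOn.norm.rpow_const fun q _ => Or.inr hθ.le).pow 2)
  · intro q hq
    have hne : e q ≠ 0 := fun h0 =>
      hq.2 (e.injOn hq.1 he.2.1 (h0.trans he.2.2.1.symm))
    have hn := norm_pos_iff.2 hne
    have hexp : Real.exp (θ * Real.log ‖e q‖) = ‖e q‖ ^ θ := by
      rw [Real.rpow_def_of_pos hn, mul_comm]
    have h2 := hpos q hq.1
    have h3 : 0 < ‖e q‖ ^ θ := Real.rpow_pos_of_pos hn θ
    rw [ConformalMetric.logDensity, hd q hq, coneProfile, hexp, ← div_pow, Real.log_pow,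
      Real.log_div (by positivity) hn.ne', Real.log_div (by positivity) h2.ne',
      Real.log_mul (by positivity) h3.ne', Real.log_rpow hn]
    push_cast
    ring

/-- The density is exactly `1 / (|z| log |z|)²`, so the continuous extension is the zero function.
-/
lemma hasCusp_of_density (he : IsCenteredCoord S p e) (h1 : ∀ q ∈ e.source, ‖e q‖ < 1)
    (hd : ∀ q ∈ e.source \ {p}, σ.density e q =
      cuspProfile (Real.log ‖e q‖) / ‖e q‖ ^ 2) : σ.HasCusp p := by
  refine ⟨e, he, h1, fun _ => 0, continuousOn_const, fun q hq => ?_⟩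
  have hne : e q ≠ 0 := fun h0 =>
    hq.2 (e.injOn hq.1 he.2.1 (h0.trans he.2.2.1.symm))
  have hn := norm_pos_iff.2 hne
  have hlog : Real.log ‖e q‖ < 0 := Real.log_neg hn (h1 q hq.1)
  rw [ConformalMetric.logDensity, hd q hq, cuspProfile, Real.log_div
    (one_div_ne_zero (pow_ne_zero 2 hlog.ne)) (by positivity),
    Real.log_div one_ne_zero (pow_ne_zero 2 hlog.ne), Real.log_one, Real.log_pow,
    Real.log_pow, Real.log_neg_eq_log]
  push_cast
  ring

end LocalModel

/-! ### The lemma for the upper half-plane -/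

/-- The case of the upper half-plane. -/
theorem localExpressions_halfPlane {M : Type u} [TopologicalSpace M] [T1Space M]
    [ChartedSpace ℂ M] [IsManifold 𝓘(ℂ) ω M] (D : M →₀ ℝ) (hD : ∀ p, -1 ≤ D p)
    (F : MultivaluedFunction.{u, v} M (D.support : Set M)) (hproj : IsProjective F)
    (hcomp : IsCompatible D F) (him : ∀ x, 0 < (F.toFun x).im) (hmon : MonodromyIn F PSL2R) :
    LocalExpressions D F halfPlaneDensity := by
  have hS : IsClosed (D.support : Set M) := D.support.finite_toSet.isClosed
  have hlocal := fun p (hp : p ∈ D.support) =>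
    exists_isLogLift_hasModel hproj.1 hmon him (by linarith [hD p] : 0 ≤ 1 + D p) (hcomp p hp)
  have hpull := pullbackMetric_isPullback hproj.1 hmon hS him
  refine ⟨fun p hp hDp => ?_, fun p hp hDp => ?_, pullbackMetric F hproj.1 hmon hS him, hpull,
    pullbackMetric_isHyperbolic hproj.1 hmon hS him, fun p hp => ⟨fun hDp => ?_, fun hDp => ?_⟩⟩
  · obtain ⟨e, c, φ, he, hs, hφ, hm, -⟩ := hlocal p hp
    obtain ⟨e', he', hconn, -, hform, -⟩ := (hm (by linarith)).exists_coord hproj hp he hs hφ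
    exact ⟨e', he', hconn, hform⟩
  · obtain ⟨e, c, φ, he, hs, hφ, -, hm⟩ := hlocal p hp
    obtain ⟨e', he', hconn, -, hform, -⟩ := (hm (by linarith)).exists_coord hproj hp he hs hφ
    exact ⟨e', he', hconn, hform⟩
  · obtain ⟨e, c, φ, he, hs, hφ, hm, -⟩ := hlocal p hp
    obtain ⟨e', he', -, h1, -, hd⟩ := (hm (by linarith)).exists_coord hproj hp he hs hφ
    exact hasCone_of_density (by linarith) he' h1 (hd _ hpull)
  · obtain ⟨e, c, φ, he, hs, hφ, -, hm⟩ := hlocal p hp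
    obtain ⟨e', he', -, h1, -, hd⟩ := (hm (by linarith)).exists_coord hproj hp he hs hφ
    exact hasCusp_of_density he' h1 (hd _ hpull)

/-! ### Transfer to the disk -/

/-- The Cayley transform from the disk to the upper half-plane. -/
def cayleyGL : GL (Fin 2) ℂ :=
  Matrix.GeneralLinearGroup.mkOfDetNeZero !![I, I; -1, 1] (by
    rw [Matrix.det_fin_two_of]
    intro h
    have := congrArg im h
    norm_num at this)

lemma cayleyGL_apply_zero_zero : cayleyGL 0 0 = I := rfl

lemma cayleyGL_apply_zero_one : cayleyGL 0 1 = I := rfl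

lemma cayleyGL_apply_one_zero : cayleyGL 1 0 = -1 := rfl

lemma cayleyGL_apply_one_one : cayleyGL 1 1 = 1 := rfl

lemma cayleyGL_denom_ne_zero {w : ℂ} (hw : ‖w‖ < 1) : cayleyGL 1 0 * w + cayleyGL 1 1 ≠ 0 := by
  rw [cayleyGL_apply_one_zero, cayleyGL_apply_one_one]
  intro h
  have : w = 1 := by linear_combination -h
  simp [this] at hw

lemma im_moebius_cayleyGL {w : ℂ} (hw : ‖w‖ < 1) :
    (moebius cayleyGL w).im = (1 - ‖w‖ ^ 2) / ‖-1 * w + 1‖ ^ 2 := by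
  have hne := cayleyGL_denom_ne_zero hw
  rw [cayleyGL_apply_one_zero, cayleyGL_apply_one_one] at hne
  have h1 : moebius cayleyGL w = (I * w + I) * conj (-1 * w + 1) / (normSq (-1 * w + 1) : ℝ) := by
    rw [moebius, cayleyGL_apply_zero_zero, cayleyGL_apply_zero_one, cayleyGL_apply_one_zero,
      cayleyGL_apply_one_one, normSq_eq_conj_mul_self, mul_comm (conj _),
      mul_div_mul_right _ _ ((map_ne_zero _).2 hne)]
  rw [h1, div_ofReal_im, normSq_eq_norm_sq, ← normSq_eq_norm_sq w, normSq_apply]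
  congr 1
  simp
  ring

lemma im_moebius_cayleyGL_pos {w : ℂ} (hw : ‖w‖ < 1) : 0 < (moebius cayleyGL w).im := by
  rw [im_moebius_cayleyGL hw]
  have hne := norm_pos_iff.2 (cayleyGL_denom_ne_zero hw)
  rw [cayleyGL_apply_one_zero, cayleyGL_apply_one_one] at hne
  have h1 : 0 < 1 - ‖w‖ ^ 2 := by nlinarith [norm_nonneg w]
  positivity

lemma halfPlaneDensity_cayleyGL {w w' : ℂ} (hw : ‖w‖ < 1) :
    halfPlaneDensity (moebius cayleyGL w) *
      ‖(cayleyGL 0 0 * cayleyGL 1 1 - cayleyGL 0 1 * cayleyGL 1 0) * w' /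
        (cayleyGL 1 0 * w + cayleyGL 1 1) ^ 2‖ ^ 2 = diskDensity w * ‖w'‖ ^ 2 := by
  have hne := norm_pos_iff.2 (cayleyGL_denom_ne_zero hw)
  rw [cayleyGL_apply_one_zero, cayleyGL_apply_one_one] at hne
  have h1 : 1 - ‖w‖ ^ 2 ≠ 0 := by nlinarith [norm_nonneg w]
  have h2 : (cayleyGL 0 0 * cayleyGL 1 1 - cayleyGL 0 1 * cayleyGL 1 0) = 2 * I := by
    rw [cayleyGL_apply_zero_zero, cayleyGL_apply_zero_one, cayleyGL_apply_one_zero,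
      cayleyGL_apply_one_one]
    ring
  rw [halfPlaneDensity, im_moebius_cayleyGL hw, h2, diskDensity, cayleyGL_apply_one_zero,
    cayleyGL_apply_one_one]
  simp only [norm_div, norm_mul, norm_pow, norm_I, Complex.norm_ofNat, mul_one]
  set N := ‖-1 * w + 1‖
  field_simp
  norm_num
  ring

/-- In real and imaginary parts of `a` and `b` the conjugate is an explicit real matrix `R`, of
determinant `|a|² - |b|²`. The check of `cayleyGL * L = R * cayleyGL` avoids computing the inverse.
-/
lemma conj_mem_PSL2R {L : GL (Fin 2) ℂ} (hL : L ∈ PSU11) :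
    cayleyGL * L * cayleyGL⁻¹ ∈ PSL2R := by
  obtain ⟨a, b, hab, hLM⟩ := hL
  rw [← normSq_eq_norm_sq, ← normSq_eq_norm_sq, normSq_apply, normSq_apply] at hab
  have hdet : (a.re + b.re) * (a.re - b.re) - (a.im - b.im) * (-(a.im + b.im)) = 1 := by
    linear_combination hab
  have hdetC : ((a.re + b.re : ℝ) : ℂ) * (a.re - b.re : ℝ) -
      (a.im - b.im : ℝ) * (-(a.im + b.im) : ℝ) ≠ 0 := by
    rw [← ofReal_mul, ← ofReal_mul, ← ofReal_sub, hdet]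
    simp
  refine ⟨a.re + b.re, a.im - b.im, -(a.im + b.im), a.re - b.re, hdet, ?_⟩
  set R : GL (Fin 2) ℂ := Matrix.GeneralLinearGroup.mkOfDetNeZero
    !![((a.re + b.re : ℝ) : ℂ), ((a.im - b.im : ℝ) : ℂ);
      ((-(a.im + b.im) : ℝ) : ℂ), ((a.re - b.re : ℝ) : ℂ)]
    (by rwa [Matrix.det_fin_two_of]) with hR
  have key : cayleyGL * L = R * cayleyGL := by
    apply Units.ext
    rw [Units.val_mul, Units.val_mul, hLM]
    change !![I, I; -1, 1] * !![a, b; star b, star a] =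
      !![((a.re + b.re : ℝ) : ℂ), ((a.im - b.im : ℝ) : ℂ);
      ((-(a.im + b.im) : ℝ) : ℂ), ((a.re - b.re : ℝ) : ℂ)] * !![I, I; -1, 1]
    ext i j
    fin_cases i <;> fin_cases j <;> apply Complex.ext <;> simp [Matrix.mul_apply] <;> ring
  rw [key, mul_inv_cancel_right]
  rfl

section Disk

variable {M : Type u} [TopologicalSpace M] {S : Set M}

/-- Composition of the values of a multivalued function with a function. -/
abbrev MultivaluedFunction.comp (T : ℂ → ℂ) (F : MultivaluedFunction.{u, v} M S) :
    MultivaluedFunction.{u, v} M S where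
  cover := F.cover
  proj := F.proj
  isCovering := F.isCovering
  surjective := F.surjective
  toFun x := T (F.toFun x)

variable {F : MultivaluedFunction.{u, v} M S}

lemma IsElement.comp (T : ℂ → ℂ) {x : F.cover} {g : M → ℂ} (hg : IsElement F x g) :
    IsElement (F.comp T) x (T ∘ g) := by
  filter_upwards [hg] with y hy
  simp [hy]

variable (hS : IsClosed S) (hdisk : ∀ x, ‖F.toFun x‖ < 1)

include hS hdisk in
lemma IsElement.eventually_norm_lt_one {x : F.cover} {g : M → ℂ} (hg : IsElement F x g) :
    ∀ᶠ q in 𝓝 (F.proj x : M), ‖g q‖ < 1 :=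
  (hg.eventually_exists hS).mono fun q ⟨y, hy, hyg⟩ => by
    rw [← hy, ← hyg.self]; exact hdisk y

include hS hdisk in
lemma IsElement.smul_eq_of_comp {x : F.cover} {g g' : M → ℂ} (hg : IsElement F x g)
    (hg' : IsElement (F.comp (moebius cayleyGL)) x g') :
    ∀ᶠ q in 𝓝 (F.proj x : M), cayleyGL • (g q : OnePoint ℂ) = (g' q : OnePoint ℂ) := by
  filter_upwards [hg'.eventuallyEq hS (hg.comp (moebius cayleyGL)),
    hg.eventually_norm_lt_one hS hdisk] with q hq hq1
  exact smul_coe_eq_coe_iff_moebius.2 ⟨cayleyGL_denom_ne_zero hq1, hq⟩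

include hS hdisk in
-- Relations between branches are conjugated by the Cayley transform. Existence of function elements
-- of `F` is needed because `ElementsRelated` is vacuous without them.
lemma ElementsRelated.comp_cayley {x y : F.cover} (hxy : F.proj x = F.proj y) {L : GL (Fin 2) ℂ}
    (hx : ∃ g, IsElement F x g) (hy : ∃ g, IsElement F y g) (h : ElementsRelated F x y L) :
    ElementsRelated (F.comp (moebius cayleyGL)) x y (cayleyGL * L * cayleyGL⁻¹) := by
  obtain ⟨g, hg⟩ := hx
  obtain ⟨k, hk⟩ := hy
  intro g' k' hg' hk'
  have h1 := hg.smul_eq_of_comp hS hdisk hg'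
  have h2 := hk.smul_eq_of_comp hS hdisk hk'
  rw [← hxy] at h2
  filter_upwards [h1, h2, h g k hg hk] with q hq1 hq2 hq3
  rw [← hq1, ← hq2, hq3, mul_smul, inv_smul_smul, mul_smul]

include hS in
lemma IsElement.comp_moebius_eventuallyEq {x : F.cover} {g g' : M → ℂ} (hg : IsElement F x g)
    (hg' : IsElement (F.comp (moebius cayleyGL)) x g') {e : OpenPartialHomeomorph M ℂ}
    (hx : (F.proj x : M) ∈ e.source) :
    g' ∘ e.symm =ᶠ[𝓝 (e (F.proj x))] moebius cayleyGL ∘ (g ∘ e.symm) :=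
  eventually_symm hx (hg'.eventuallyEq hS (hg.comp (moebius cayleyGL)))

include hdisk in
lemma IsElement.denom_ne_zero {x : F.cover} {g : M → ℂ} (hg : IsElement F x g)
    {e : OpenPartialHomeomorph M ℂ} (hx : (F.proj x : M) ∈ e.source) :
    cayleyGL 1 0 * (g ∘ e.symm) (e (F.proj x)) + cayleyGL 1 1 ≠ 0 := by
  rw [Function.comp_apply, e.left_inv hx, ← hg.self]
  exact cayleyGL_denom_ne_zero (hdisk x)

variable [ChartedSpace ℂ M]

include hdisk in
lemma IsLocallyUnivalent.comp_cayley (hF : IsLocallyUnivalent F) :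
    IsLocallyUnivalent (F.comp (moebius cayleyGL)) := by
  intro x
  obtain ⟨g, hg, hge⟩ := hF x
  refine ⟨_, hg.comp (moebius cayleyGL), fun e he hx => ?_⟩
  obtain ⟨hga, hgd⟩ := hge e he hx
  have hne := hg.denom_ne_zero hdisk hx
  refine ⟨(analyticAt_moebius cayleyGL hne).comp hga, ?_⟩
  rw [Function.comp_assoc, deriv_comp _ (analyticAt_moebius cayleyGL hne).differentiableAt
    hga.differentiableAt]
  exact mul_ne_zero (deriv_moebius_ne_zero cayleyGL hne) hgd

include hS hdisk in
lemma IsProjective.comp_cayley (hF : IsProjective F) :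
    IsProjective (F.comp (moebius cayleyGL)) := by
  refine ⟨hF.1.comp_cayley hdisk, fun x y hxy => ?_⟩
  obtain ⟨L, hL⟩ := hF.2 x y hxy
  exact ⟨_, hL.comp_cayley hS hdisk hxy ((hF.1 x).imp fun _ h => h.1)
    ((hF.1 y).imp fun _ h => h.1)⟩

include hS hdisk in
lemma MonodromyIn.comp_cayley (hF : IsLocallyUnivalent F) (hmon : MonodromyIn F PSU11) :
    MonodromyIn (F.comp (moebius cayleyGL)) PSL2R := by
  intro p γ x
  obtain ⟨L, hL, hrel⟩ := hmon p γ x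
  refine ⟨_, conj_mem_PSL2R hL, hrel.comp_cayley hS hdisk ?_ ((hF _).imp fun _ h => h.1)
    ((hF _).imp fun _ h => h.1)⟩
  exact (F.isCovering.monodromy γ x).2.trans x.2.symm

include hS hdisk in
-- The Schwarzian derivative does not see the Cayley transform, so coordinate, constant and
-- holomorphic part are unchanged.
lemma SchwarzianForm.comp_cayley (hF : IsLocallyUnivalent F) {p : M} {θ : ℝ}
    (h : SchwarzianForm F p θ) : SchwarzianForm (F.comp (moebius cayleyGL)) p θ := by
  obtain ⟨e, he, d, ϕ, hϕ, hform⟩ := h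
  refine ⟨e, he, d, ϕ, hϕ, fun x g' hx hg' => ?_⟩
  obtain ⟨g, hg, hge⟩ := hF x
  obtain ⟨hga, hgd⟩ := hge e he.1 hx
  rw [schwarzian_congr (hg.comp_moebius_eventuallyEq hS hg' hx),
    schwarzian_moebius_comp cayleyGL hga hgd (hg.denom_ne_zero hdisk hx)]
  exact hform x g hx hg

include hdisk in
lemma HasLocalForm.of_comp_cayley {p : M} {Φ : ℂ → ℂ}
    (h : HasLocalForm (F.comp (moebius cayleyGL)) p Φ) : HasLocalForm F p Φ := by
  obtain ⟨e, he, hconn, hform⟩ := h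
  refine ⟨e, he, hconn, fun x₀ hx₀ => ?_⟩
  obtain ⟨L, hL⟩ := hform x₀ hx₀
  refine ⟨L * cayleyGL, fun x hx => ?_⟩
  obtain ⟨ℓ, hℓ, hev⟩ := hL x hx
  refine ⟨ℓ, hℓ, hev.mono fun y hy => ?_⟩
  rw [← hy, mul_smul]
  congr 1
  exact smul_coe_eq_coe_iff_moebius.2 ⟨cayleyGL_denom_ne_zero (hdisk y), rfl⟩

include hdisk in
lemma ConformalMetric.IsPullback.of_comp_cayley (hF : IsLocallyUnivalent F) (hS : IsClosed S)
    {σ : ConformalMetric M S}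
    (h : σ.IsPullback (F.comp (moebius cayleyGL)) halfPlaneDensity) :
    σ.IsPullback F diskDensity := by
  intro e he x g hx hg
  obtain ⟨g₀, hg₀, hge⟩ := hF x
  have hga : AnalyticAt ℂ (g ∘ e.symm) (e (F.proj x)) :=
    (hge e he hx).1.congr (eventually_symm hx (hg₀.eventuallyEq hS hg))
  have h1 := h e he x _ hx (hg.comp (moebius cayleyGL))
  have h2 : deriv ((moebius cayleyGL ∘ g) ∘ e.symm) (e (F.proj x)) = _ :=
    (hasDerivAt_moebius_comp cayleyGL hga.differentiableAt.hasDerivAt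
      (hg.denom_ne_zero hdisk hx)).deriv
  have h3 : (g ∘ e.symm) (e (F.proj x)) = F.toFun x := by
    rw [Function.comp_apply, e.left_inv hx, hg.self]
  rw [h3] at h2
  rw [← halfPlaneDensity_cayleyGL (hdisk x), ← h2]
  exact h1

end Disk

/-- The case of the disk. -/
theorem localExpressions_disk {M : Type u} [TopologicalSpace M] [T1Space M]
    [ChartedSpace ℂ M] [IsManifold 𝓘(ℂ) ω M] (D : M →₀ ℝ) (hD : ∀ p, -1 ≤ D p)
    (F : MultivaluedFunction.{u, v} M (D.support : Set M)) (hproj : IsProjective F)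
    (hcomp : IsCompatible D F) (hdisk : ∀ x, ‖F.toFun x‖ < 1) (hmon : MonodromyIn F PSU11) :
    LocalExpressions D F diskDensity := by
  have hS : IsClosed (D.support : Set M) := D.support.finite_toSet.isClosed
  obtain ⟨h1, h2, σ, hσ, hhyp, hrep⟩ := localExpressions_halfPlane D hD
    (F.comp (moebius cayleyGL)) (hproj.comp_cayley hS hdisk)
    (fun p hp => (hcomp p hp).comp_cayley hS hdisk hproj.1)
    (fun x => im_moebius_cayleyGL_pos (hdisk x)) (hmon.comp_cayley hS hdisk hproj.1)
  exact ⟨fun p hp hDp => HasLocalForm.of_comp_cayley hdisk (h1 p hp hDp),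
    fun p hp hDp => HasLocalForm.of_comp_cayley hdisk (h2 p hp hDp), σ,
    hσ.of_comp_cayley hdisk hproj.1 hS, hhyp, hrep⟩

end HypSing

end

theorem lemma2p4 {M : Type*} [TopologicalSpace M] [T2Space M] [ConnectedSpace M]
    [ChartedSpace ℂ M] [IsManifold 𝓘(ℂ) ω M]
    (D : M →₀ ℝ) (hD : ∀ p, -1 ≤ D p)
    (F : HypSing.MultivaluedFunction M (D.support : Set M))
    (hproj : HypSing.IsProjective F) (hcomp : HypSing.IsCompatible D F) :
    ((∀ x, F.toFun x ∈ Metric.ball (0 : ℂ) 1) → HypSing.MonodromyIn F HypSing.PSU11 →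
      HypSing.LocalExpressions D F HypSing.diskDensity) ∧
    ((∀ x, 0 < (F.toFun x).im) → HypSing.MonodromyIn F HypSing.PSL2R →
      HypSing.LocalExpressions D F HypSing.halfPlaneDensity) :=
  ⟨fun h hmon => HypSing.localExpressions_disk D hD F hproj hcomp
      (fun x => mem_ball_zero_iff.1 (h x)) hmon,
    fun h hmon => HypSing.localExpressions_halfPlane D hD F hproj hcomp h hmon⟩
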